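/- **Setting.** For $k\in\mathbb N$ let $\mathcal H_k=(\mathbb C^2)^{\otimes k}$. A *QPT* is a polynomial-time uniform family of quantum circuits $(\mathcal A_n)_n$, indexed by the security parameter $n$: some polynomial-time Turing machine prints, on input $1^n$, a description of $\mathcal A_n$. The gates are preparation of $|0\rangle$, partial trace, measurement in the computational basis, Hadamard, $T$ and CNOT (a finite universal set); a QPT with oracle access may also use gates that apply given maps. All registers are uniform families of polynomial size. A function $\varepsilon$ is negligible if for every nonzero polynomial $p$ with coefficients in $\mathbb N$ one has $\varepsilon(n)<1/p(n)$ for all sufficiently large $n$. A *quantum public-key encryption scheme* consists of QPTs $\mathsf{KeyGen}:1^n\mapsto(pk,sk)\in\{0,1\}^{p(n)}\times\{0,1\}^n$ (classical output), $\mathsf{Enc}_{pk}:\mathcal H_M\to\mathcal H_C$ and $\mathsf{Dec}_{sk}:\mathcal H_C\to\mathcal H_M$ (admissible maps between operators on these spaces, the classical key being a further input), where $M$ and $C$ have $m(n)$ and $c(n)$ qubits, such that for some negligible $\varepsilon$, $\|\mathsf{Dec}_{sk}\circ\mathsf{Enc}_{pk}-\mathbb 1_M\|_\diamond\le\varepsilon(n)$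 for all $n$ and all $(pk,sk)$ that $\mathsf{KeyGen}(1^n)$ outputs with positive probability. In a *quantum private-key encryption scheme*, $\mathsf{KeyGen}(1^n)$ outputs one key $k\in\{0,1\}^n$, and $pk$ and $sk$ below are both $k$. In the public-key setting every algorithm in the games below receives $pk$ as an additional input; in the private-key setting none of them receives any key. **IND.** A scheme has *indistinguishable encryptions* if for all QPTs $\mathcal M$ (outputting a state $\rho_{ME}$ of a plaintext register $M$ and a register $E$) and $\mathcal D$ (outputting a bit), the quantity $$\Big|\Pr\big[\mathcal D\{(\mathsf{Enc}_{pk}\otimes\mathbb 1_E)\rho_{ME}\}=1\big]-\Pr\big[\mathcal D\{(\mathsf{Enc}_{pk}\otimes\mathbb 1_E)(|0\rangle\langle0|_M\otimes\rho_E)\}=1\big]\Big|$$ is negligible in $n$, where $\rho_E=\mathrm{tr}_M\,\rho_{ME}$. **SEM.** A scheme is *semantically secure* if for every QPT $\mathcal A$ (acting on registers $C$ and $E$) there is a QPT $\mathcal S$ (acting on $E$, with the same output register as $\mathcal A$) such that for all QPTs $\mathcal M$ (outputting a state $\rho_{MEF}$ of a plaintext register $M$, the register $E$ and a further register $F$)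 and $\mathcal D$ (outputting a bit), the quantity $$\Big|\Pr\big[\mathcal D\{(\mathcal A\otimes\mathbb 1_F)(\mathsf{Enc}_{pk}\otimes\mathbb 1_{EF})\rho_{MEF}\}=1\big]-\Pr\big[\mathcal D\{(\mathcal S\otimes\mathbb 1_F)\rho_{EF}\}=1\big]\Big|$$ is negligible in $n$, where $\rho_{EF}=\mathrm{tr}_M\,\rho_{MEF}$. In both definitions the probabilities are over $\mathsf{KeyGen}(1^n)$ and the internal randomness of all algorithms. In the *CPA* variants (IND-CPA, SEM-CPA) all of $\mathcal M,\mathcal D$, respectively $\mathcal M,\mathcal A,\mathcal S,\mathcal D$, also have oracle access to $\mathsf{Enc}_{pk}$. In the *CCA1* variants $\mathcal M$ has, in addition to this, oracle access to $\mathsf{Dec}_{sk}$. **Theorem.** For every quantum public-key encryption scheme and for every quantum private-key encryption scheme: it is SEM if and only if it is IND; it is SEM-CPA if and only if it is IND-CPA; and it is SEM-CCA1 if and only if it is IND-CCA1. -/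

import Mathlib

open scoped Kronecker

noncomputable section

namespace QEnc

/-! ### Registers -/

/-- A quantum register: a block of `k` qubits, or a pair of registers. -/
inductive Reg : Type
  | qubits (k : ℕ) : Reg
  | pair (R S : Reg) : Reg

infixr:70 " ⊗ᵣ " => Reg.pair

/-- The labels of the computational basis of a register: bit strings, and pairs of labels. The
Hilbert space of the register is `ℂ ^ R.Basis`. -/
@[reducible] def Reg.Basis : Reg → Type
  | .qubits k => Fin k → Bool
  | .pair R S => Reg.Basis R × Reg.Basis S

instance Reg.instFintypeBasis : (R : Reg) → Fintype R.Basis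
  | .qubits k => inferInstanceAs (Fintype (Fin k → Bool))
  | .pair R S =>
    letI := Reg.instFintypeBasis R
    letI := Reg.instFintypeBasis S
    inferInstanceAs (Fintype (R.Basis × S.Basis))

instance Reg.instDecidableEqBasis : (R : Reg) → DecidableEq R.Basis
  | .qubits k => inferInstanceAs (DecidableEq (Fin k → Bool))
  | .pair R S =>
    letI := Reg.instDecidableEqBasis R
    letI := Reg.instDecidableEqBasis S
    inferInstanceAs (DecidableEq (R.Basis × S.Basis))

/-- The label of the all-zero basis state. -/
def Reg.zero : (R : Reg) → R.Basis
  | .qubits _ => fun _ => false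
  | .pair R S => (Reg.zero R, Reg.zero S)

/-! ### Operators and maps on them -/

section Maps

variable {A B C : Type}

/-- Linear maps from operators on `ℂ ^ A` to operators on `ℂ ^ B`. -/
abbrev SOp (A B : Type) : Type := Matrix A A ℂ →ₗ[ℂ] Matrix B B ℂ

/-- The projector `|x⟩⟨x|`. -/
def ketbra [DecidableEq A] (x : A) : Matrix A A ℂ := Matrix.single x x 1

/-- `Φ ⊗ 𝟙_C`. -/
def tensorId (Φ : SOp A B) (C : Type) : SOp (A × C) (B × C) where
  toFun X := Matrix.of fun p q => Φ (Matrix.of fun a a' => X (a, p.2) (a', q.2)) p.1 q.1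
  map_add' X Y := by
    ext p q
    exact congrFun (congrFun (Φ.map_add (Matrix.of fun a a' => X (a, p.2) (a', q.2))
      (Matrix.of fun a a' => Y (a, p.2) (a', q.2))) p.1) q.1
  map_smul' r X := by
    ext p q
    exact congrFun (congrFun (Φ.map_smul r (Matrix.of fun a a' => X (a, p.2) (a', q.2))) p.1) q.1

/-- The map `X ↦ Φ (|x⟩⟨x| ⊗ X)`: the first input of `Φ` is fixed to the classical value `x`. -/
def feed [DecidableEq A] (x : A) (Φ : SOp (A × B) C) : SOp B C where
  toFun X := Φ (ketbra x ⊗ₖ X)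
  map_add' X Y := by rw [Matrix.kronecker_add, map_add]
  map_smul' r X := by rw [Matrix.kronecker_smul, map_smul, RingHom.id_apply]

/-- Renaming of basis states along a bijection. -/
def relabel (e : A ≃ B) : SOp A B := (Matrix.reindexLinearEquiv ℂ ℂ e e).toLinearMap

/-- Conjugation `X ↦ U X U†`. -/
def conjugate [Fintype A] (U : Matrix A A ℂ) : SOp A A where
  toFun X := U * X * U.conjTranspose
  map_add' X Y := by rw [mul_add, add_mul]
  map_smul' r X := by simp

/-- The map `X ↦ tr(X) |x⟩⟨x|`: trace out the input and prepare `|x⟩⟨x|`. -/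
def replaceBy [Fintype A] [DecidableEq B] (x : B) : SOp A B where
  toFun X := X.trace • ketbra x
  map_add' X Y := by rw [Matrix.trace_add, add_smul]
  map_smul' r X := by rw [Matrix.trace_smul, smul_assoc, RingHom.id_apply]

/-- Measurement in the computational basis, the outcome being kept. -/
def dephase [DecidableEq A] : SOp A A where
  toFun X := Matrix.diagonal X.diag
  map_add' X Y := (Matrix.diagonal_add X.diag Y.diag).symm
  map_smul' r X := by rw [Matrix.diag_smul, Matrix.diagonal_smul, RingHom.id_apply]

/-- The partial trace over the first factor. -/
def traceFst [Fintype A] (X : Matrix (A × B) (A × B) ℂ) : Matrix B B ℂ :=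
  Matrix.of fun b b' => ∑ a, X (a, b) (a, b')

/-- The trace norm: the sum of the singular values. -/
def traceNorm [Fintype A] [DecidableEq A] (X : Matrix A A ℂ) : ℝ :=
  ∑ i, √((Matrix.isHermitian_conjTranspose_mul_self X).eigenvalues i)

/-- The diamond norm: the supremum of `‖(Φ ⊗ 𝟙_k) X‖₁` over all finite dimensions `k` and all `X`
with `‖X‖₁ ≤ 1`. -/
def diamondNorm [Fintype A] [DecidableEq A] [Fintype B] [DecidableEq B] (Φ : SOp A B) : ENNReal :=
  ⨆ (k : ℕ) (X : Matrix (A × Fin k) (A × Fin k) ℂ) (_ : traceNorm X ≤ 1),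
    ENNReal.ofReal (traceNorm (tensorId Φ (Fin k) X))

end Maps

/-! ### Quantum circuits with oracle gates -/

/-- The two oracles: encryption and decryption. -/
inductive Oracle : Type
  | enc
  | dec

/-- Input register of an oracle, for `m`-qubit plaintexts and `c`-qubit ciphertexts. -/
@[reducible] def Oracle.dom (m c : ℕ) : Oracle → Reg
  | .enc => .qubits m
  | .dec => .qubits c

/-- Output register of an oracle, for `m`-qubit plaintexts and `c`-qubit ciphertexts. -/
@[reducible] def Oracle.cod (m c : ℕ) : Oracle → Reg
  | .enc => .qubits c
  | .dec => .qubits m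

/-- Elementary steps. Up to `tUnit'` they only rearrange wires. The others stand for `k` parallel
applications of one gate from the finite universal set {preparation of `|0⟩`, partial trace,
measurement, Hadamard, `T`, CNOT}, on `k` wires (for CNOT: on `k` controls and `k` targets). -/
inductive Gate : Reg → Reg → Type
  | wires (R : Reg) : Gate R R
  | swap (R S : Reg) : Gate (R ⊗ᵣ S) (S ⊗ᵣ R)
  | assoc (R S T : Reg) : Gate ((R ⊗ᵣ S) ⊗ᵣ T) (R ⊗ᵣ (S ⊗ᵣ T))
  | assoc' (R S T : Reg) : Gate (R ⊗ᵣ (S ⊗ᵣ T)) ((R ⊗ᵣ S) ⊗ᵣ T)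
  | split (a b : ℕ) : Gate (.qubits (a + b)) (.qubits a ⊗ᵣ .qubits b)
  | merge (a b : ℕ) : Gate (.qubits a ⊗ᵣ .qubits b) (.qubits (a + b))
  | tUnit (R : Reg) : Gate R (.qubits 0 ⊗ᵣ R)
  | tUnit' (R : Reg) : Gate (.qubits 0 ⊗ᵣ R) R
  | init (k : ℕ) : Gate (.qubits 0) (.qubits k)
  | discard (R : Reg) : Gate R (.qubits 0)
  | measure (k : ℕ) : Gate (.qubits k) (.qubits k)
  | hadamard (k : ℕ) : Gate (.qubits k) (.qubits k)
  | phase (k : ℕ) : Gate (.qubits k) (.qubits k)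
  | cnot (k : ℕ) : Gate (.qubits k ⊗ᵣ .qubits k) (.qubits k ⊗ᵣ .qubits k)

/-- Quantum circuits built from elementary steps and oracle gates by sequential composition
(`seq C D`: first `C`, then `D`) and by adding idle wires (`frame C T` is `C ⊗ 𝟙_T`). The numbers
`m` and `c` are the sizes of the oracles' plaintext and ciphertext registers. -/
inductive Circ (m c : ℕ) : Reg → Reg → Type
  | gate {R S : Reg} (g : Gate R S) : Circ m c R S
  | oracle (o : Oracle) : Circ m c (o.dom m c) (o.cod m c)
  | seq {R S T : Reg} (C : Circ m c R S) (D : Circ m c S T) : Circ m c R T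
  | frame {R S : Reg} (C : Circ m c R S) (T : Reg) : Circ m c (R ⊗ᵣ T) (S ⊗ᵣ T)

/-- The `k`-fold tensor power of the Hadamard gate. -/
def hadamardMatrix (k : ℕ) : Matrix (Fin k → Bool) (Fin k → Bool) ℂ :=
  Matrix.of fun x y => ∏ i, if x i && y i then -(1 / (√2 : ℂ)) else 1 / (√2 : ℂ)

/-- The `k`-fold tensor power of the gate `T = diag(1, exp(iπ/4))`. -/
def phaseMatrix (k : ℕ) : Matrix (Fin k → Bool) (Fin k → Bool) ℂ :=
  Matrix.diagonal fun x => ∏ i, if x i then Complex.exp (Complex.I * Real.pi / 4) else 1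

/-- The permutation `|x, y⟩ ↦ |x, x ⊕ y⟩` of basis states. -/
def cnotEquiv (k : ℕ) : Equiv.Perm ((Fin k → Bool) × (Fin k → Bool)) :=
  Function.Involutive.toPerm (fun p => (p.1, fun i => xor (p.1 i) (p.2 i))) fun p => by
    ext <;> simp

/-- The admissible map that an elementary step performs. -/
def Gate.sem : {R S : Reg} → Gate R S → SOp R.Basis S.Basis
  | _, _, .wires R => relabel (Equiv.refl R.Basis)
  | _, _, .swap R S => relabel (Equiv.prodComm R.Basis S.Basis)
  | _, _, .assoc R S T => relabel (Equiv.prodAssoc R.Basis S.Basis T.Basis)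
  | _, _, .assoc' R S T => relabel (Equiv.prodAssoc R.Basis S.Basis T.Basis).symm
  | _, _, .split a b => relabel (Fin.appendEquiv a b).symm
  | _, _, .merge a b => relabel (Fin.appendEquiv a b)
  | _, _, .tUnit R => relabel (Equiv.uniqueProd R.Basis (Fin 0 → Bool)).symm
  | _, _, .tUnit' R => relabel (Equiv.uniqueProd R.Basis (Fin 0 → Bool))
  | _, _, .init k => replaceBy (Reg.zero (.qubits k))
  | _, _, .discard _ => replaceBy (Reg.zero (.qubits 0))
  | _, _, .measure _ => dephase
  | _, _, .hadamard k => conjugate (hadamardMatrix k)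
  | _, _, .phase k => conjugate (phaseMatrix k)
  | _, _, .cnot k => relabel (cnotEquiv k)

/-- An interpretation of the oracle gates by maps. -/
abbrev OracleMaps (m c : ℕ) : Type :=
  (o : Oracle) → SOp (o.dom m c).Basis (o.cod m c).Basis

/-- The map that a circuit performs, for a given interpretation of its oracle gates. -/
def Circ.sem {m c : ℕ} (O : OracleMaps m c) : {R S : Reg} → Circ m c R S → SOp R.Basis S.Basis
  | _, _, .gate g => g.sem
  | _, _, .oracle o => O o
  | _, _, .seq C D => (D.sem O) ∘ₗ (C.sem O)
  | _, _, .frame C T => tensorId (C.sem O) T.Basis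

/-- The oracles that occur in a circuit. -/
def Circ.oracles {m c : ℕ} : {R S : Reg} → Circ m c R S → Set Oracle
  | _, _, .gate _ => ∅
  | _, _, .oracle o => {o}
  | _, _, .seq C D => C.oracles ∪ D.oracles
  | _, _, .frame C _ => C.oracles

/-! ### Descriptions of circuits and polynomial-time uniformity -/

/-- The alphabet in which circuits are described. -/
inductive Tok : Type
  | mark | qubits | pair
  | wires | swap | assoc | assoc' | split | merge | tUnit | tUnit'
  | init | discard | measure | hadamard | phase | cnot
  | enc | dec | seq | frame
  deriving DecidableEq

instance : Fintype Tok :=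
  Fintype.ofList [.mark, .qubits, .pair, .wires, .swap, .assoc, .assoc', .split, .merge, .tUnit,
    .tUnit', .init, .discard, .measure, .hadamard, .phase, .cnot, .enc, .dec, .seq, .frame] fun x => by
    cases x <;> simp

/-- The description of `k` qubits: `k` in unary, and an end marker. -/
def qubitsCode (k : ℕ) : List Tok := List.replicate k Tok.mark ++ [Tok.qubits]

/-- The description of a register, in prefix notation. -/
def Reg.code : Reg → List Tok
  | .qubits k => qubitsCode k
  | .pair R S => Tok.pair :: (R.code ++ S.code)

/-- The description of an elementary step; all sizes are written in unary. -/
def Gate.code : {R S : Reg} → Gate R S → List Tok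
  | _, _, .wires R => Tok.wires :: R.code
  | _, _, .swap R S => Tok.swap :: (R.code ++ S.code)
  | _, _, .assoc R S T => Tok.assoc :: (R.code ++ S.code ++ T.code)
  | _, _, .assoc' R S T => Tok.assoc' :: (R.code ++ S.code ++ T.code)
  | _, _, .split a b => Tok.split :: (qubitsCode a ++ qubitsCode b)
  | _, _, .merge a b => Tok.merge :: (qubitsCode a ++ qubitsCode b)
  | _, _, .tUnit R => Tok.tUnit :: R.code
  | _, _, .tUnit' R => Tok.tUnit' :: R.code
  | _, _, .init k => Tok.init :: qubitsCode k
  | _, _, .discard R => Tok.discard :: R.code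
  | _, _, .measure k => Tok.measure :: qubitsCode k
  | _, _, .hadamard k => Tok.hadamard :: qubitsCode k
  | _, _, .phase k => Tok.phase :: qubitsCode k
  | _, _, .cnot k => Tok.cnot :: qubitsCode k

/-- The description of an oracle gate, with the sizes of its registers. -/
def Oracle.code (m c : ℕ) : Oracle → List Tok
  | .enc => Tok.enc :: (qubitsCode m ++ qubitsCode c)
  | .dec => Tok.dec :: (qubitsCode c ++ qubitsCode m)

/-- The description of a circuit, in prefix notation. Its length is at least the number of gates,
and at least the number of input wires and of output wires. -/
def Circ.code {m c : ℕ} : {R S : Reg} → Circ m c R S → List Tok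
  | _, _, .gate g => g.code
  | _, _, .oracle o => o.code m c
  | _, _, .seq C D => Tok.seq :: (C.code ++ D.code)
  | _, _, .frame C T => Tok.frame :: (C.code ++ T.code)

/-- Some polynomial-time Turing machine prints `s n` on input `1ⁿ`. -/
def Printable (s : ℕ → List Tok) : Prop :=
  Nonempty (Turing.TM2ComputableInPolyTime Computability.unaryEncodeNat
    (id : List Tok → List Tok) s)

/-- A uniform family of registers; in particular, their sizes are polynomial in `n`. -/
structure RegFamily where
  reg : ℕ → Reg
  uniform : Printable fun n => (reg n).code

/-- A quantum polynomial-time algorithm (QPT) with input register `R n` and output register `S n`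
for the security parameter `n`, and with access to the oracles in `Ω`: a polynomial-time uniform
family of quantum circuits. -/
structure QPT (m c : ℕ → ℕ) (Ω : Set Oracle) (R S : ℕ → Reg) where
  circ : (n : ℕ) → Circ (m n) (c n) (R n) (S n)
  uniform : Printable fun n => (circ n).code
  oracles_subset : ∀ n, (circ n).oracles ⊆ Ω

/-- The map performed by the `n`-th circuit of an algorithm without oracles (so that the
interpretation of oracle gates does not matter). -/
def QPT.plain {m c : ℕ → ℕ} {R S : ℕ → Reg} (Q : QPT m c ∅ R S) (n : ℕ) :
    SOp (R n).Basis (S n).Basis :=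
  (Q.circ n).sem fun _ => 0

/-- Negligible functions. -/
def Negligible (ε : ℕ → ℝ) : Prop :=
  ∀ p : Polynomial ℕ, p ≠ 0 → ∀ᶠ n in Filter.atTop, ε n < 1 / ((p.eval n : ℕ) : ℝ)

/-! ### Encryption schemes for quantum data -/

/-- The sizes and the three algorithms of a symmetric-key scheme. The `n`-th circuit of `keyGen`
has no input wires; its `n` output bits are obtained by measurement. -/
structure SKETriple where
  msgLen : ℕ → ℕ
  ctLen : ℕ → ℕ
  msgLen_uniform : Printable fun n => (Reg.qubits (msgLen n)).code
  ctLen_uniform : Printable fun n => (Reg.qubits (ctLen n)).code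
  keyGen : QPT msgLen ctLen ∅ (fun _ => .qubits 0) (fun n => .qubits n)
  enc : QPT msgLen ctLen ∅ (fun n => .qubits n ⊗ᵣ .qubits (msgLen n)) (fun n => .qubits (ctLen n))
  dec : QPT msgLen ctLen ∅ (fun n => .qubits n ⊗ᵣ .qubits (ctLen n)) (fun n => .qubits (msgLen n))

namespace SKETriple

variable (P : SKETriple) (n : ℕ)

/-- The probability that `keyGen` outputs the key `k`. -/
def keyProb (k : Fin n → Bool) : ℝ :=
  (P.keyGen.plain n (ketbra (Reg.zero (.qubits 0))) k k).re

/-- Encryption under the key `k`. -/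
def encMap (k : Fin n → Bool) : SOp (Fin (P.msgLen n) → Bool) (Fin (P.ctLen n) → Bool) :=
  feed k (P.enc.plain n)

/-- Decryption under the key `k`. -/
def decMap (k : Fin n → Bool) : SOp (Fin (P.ctLen n) → Bool) (Fin (P.msgLen n) → Bool) :=
  feed k (P.dec.plain n)

end SKETriple

/-- Quantum symmetric-key encryption schemes. -/
structure SKEScheme extends SKETriple where
  correct : ∃ ε : ℕ → ℝ, Negligible ε ∧ ∀ (n : ℕ) (k : Fin n → Bool),
    0 < toSKETriple.keyProb n k →
      diamondNorm (toSKETriple.decMap n k ∘ₗ toSKETriple.encMap n k - LinearMap.id) ≤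
        ENNReal.ofReal (ε n)

/-- The sizes and the three algorithms of a public-key scheme, with public keys of `pkLen n` bits
and private keys of `n` bits. The `n`-th circuit of `keyGen` has no input wires; its output bits
are obtained by measurement. -/
structure PKETriple where
  pkLen : ℕ → ℕ
  msgLen : ℕ → ℕ
  ctLen : ℕ → ℕ
  pkLen_uniform : Printable fun n => (Reg.qubits (pkLen n)).code
  msgLen_uniform : Printable fun n => (Reg.qubits (msgLen n)).code
  ctLen_uniform : Printable fun n => (Reg.qubits (ctLen n)).code
  keyGen : QPT msgLen ctLen ∅ (fun _ => .qubits 0) (fun n => .qubits (pkLen n) ⊗ᵣ .qubits n)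
  enc : QPT msgLen ctLen ∅ (fun n => .qubits (pkLen n) ⊗ᵣ .qubits (msgLen n))
    (fun n => .qubits (ctLen n))
  dec : QPT msgLen ctLen ∅ (fun n => .qubits n ⊗ᵣ .qubits (ctLen n)) (fun n => .qubits (msgLen n))

namespace PKETriple

variable (P : PKETriple) (n : ℕ)

/-- The probability that `keyGen` outputs the key pair `κ = (pk, sk)`. -/
def keyProb (κ : (Fin (P.pkLen n) → Bool) × (Fin n → Bool)) : ℝ :=
  (P.keyGen.plain n (ketbra (Reg.zero (.qubits 0))) κ κ).re

/-- Encryption under the public key `pk`. -/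
def encMap (pk : Fin (P.pkLen n) → Bool) :
    SOp (Fin (P.msgLen n) → Bool) (Fin (P.ctLen n) → Bool) :=
  feed pk (P.enc.plain n)

/-- Decryption under the private key `sk`. -/
def decMap (sk : Fin n → Bool) : SOp (Fin (P.ctLen n) → Bool) (Fin (P.msgLen n) → Bool) :=
  feed sk (P.dec.plain n)

end PKETriple

/-- Quantum public-key encryption schemes. -/
structure PKEScheme extends PKETriple where
  correct : ∃ ε : ℕ → ℝ, Negligible ε ∧
    ∀ (n : ℕ) (pk : Fin (toPKETriple.pkLen n) → Bool) (sk : Fin n → Bool),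
      0 < toPKETriple.keyProb n (pk, sk) →
        diamondNorm (toPKETriple.decMap n sk ∘ₗ toPKETriple.encMap n pk - LinearMap.id) ≤
          ENNReal.ofReal (ε n)

/-! ### The security games -/

/-- The data that the games refer to, in the symmetric-key and in the public-key setting alike: the
distribution of keys, the public part of a key, and encryption and decryption under a key. -/
structure Setting where
  msgLen : ℕ → ℕ
  ctLen : ℕ → ℕ
  Key : ℕ → Type
  [keyFintype : (n : ℕ) → Fintype (Key n)]
  prob : (n : ℕ) → Key n → ℝ
  pubReg : ℕ → Reg
  pub : (n : ℕ) → Key n → (pubReg n).Basis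
  enc : (n : ℕ) → Key n → SOp (Fin (msgLen n) → Bool) (Fin (ctLen n) → Bool)
  dec : (n : ℕ) → Key n → SOp (Fin (ctLen n) → Bool) (Fin (msgLen n) → Bool)

attribute [instance] Setting.keyFintype

/-- The symmetric-key setting: encryption and decryption use the same key, and the public register
is blank. -/
def SKEScheme.setting (P : SKEScheme) : Setting where
  msgLen := P.msgLen
  ctLen := P.ctLen
  Key n := Fin n → Bool
  prob := P.keyProb
  pubReg _ := .qubits 0
  pub _ _ := Reg.zero (.qubits 0)
  enc := P.encMap
  dec := P.decMap

/-- The public-key setting: a key is a pair `(pk, sk)`, and the public register contains `pk`. -/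
def PKEScheme.setting (P : PKEScheme) : Setting where
  msgLen := P.msgLen
  ctLen := P.ctLen
  Key n := (Fin (P.pkLen n) → Bool) × (Fin n → Bool)
  prob := P.keyProb
  pubReg n := .qubits (P.pkLen n)
  pub _ κ := κ.1
  enc n κ := P.encMap n κ.1
  dec n κ := P.decMap n κ.2

/-- The three kinds of attack: without oracles, with chosen plaintexts (CPA), and with
non-adaptively chosen ciphertexts (CCA1). -/
inductive Attack : Type
  | passive
  | cpa
  | cca1

/-- The oracles available to the message generator. -/
def Attack.genOracles : Attack → Set Oracle
  | .passive => ∅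
  | .cpa => {Oracle.enc}
  | .cca1 => {Oracle.enc, Oracle.dec}

/-- The oracles available to the adversary, the simulator and the distinguisher. -/
def Attack.oracles : Attack → Set Oracle
  | .passive => ∅
  | .cpa => {Oracle.enc}
  | .cca1 => {Oracle.enc}

/-- The probability that measuring a qubit in state `ρ` gives `1`. -/
def probOne (ρ : Matrix (Fin 1 → Bool) (Fin 1 → Bool) ℂ) : ℝ :=
  (ρ (fun _ => true) (fun _ => true)).re

namespace Setting

variable (P : Setting)

/-- The average of `f` over the keys. -/
def mean (n : ℕ) (f : P.Key n → ℝ) : ℝ := ∑ κ, P.prob n κ * f κ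

/-- The oracles for the key `κ`. -/
def oracleMaps (n : ℕ) (κ : P.Key n) : OracleMaps (P.msgLen n) (P.ctLen n)
  | .enc => P.enc n κ
  | .dec => P.dec n κ

/-- Message generators: from the public register, a plaintext and a register `E`. -/
abbrev Generator (a : Attack) (E : ℕ → Reg) : Type :=
  QPT P.msgLen P.ctLen a.genOracles P.pubReg (fun n => .qubits (P.msgLen n) ⊗ᵣ E n)

/-- The other parties: from the public register and a register `R`, a register `S`. -/
abbrev Party (a : Attack) (R S : ℕ → Reg) : Type :=
  QPT P.msgLen P.ctLen a.oracles (fun n => P.pubReg n ⊗ᵣ R n) S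

variable {P}

/-- The state that the message generator outputs when the key is `κ`. -/
def Generator.state {a : Attack} {E : ℕ → Reg} (M : P.Generator a E) (n : ℕ) (κ : P.Key n) :
    Matrix ((Fin (P.msgLen n) → Bool) × (E n).Basis)
      ((Fin (P.msgLen n) → Bool) × (E n).Basis) ℂ :=
  (M.circ n).sem (P.oracleMaps n κ) (ketbra (P.pub n κ))

/-- The map that a party performs on `R` when the key is `κ`. -/
def Party.run {a : Attack} {R S : ℕ → Reg} (A : P.Party a R S) (n : ℕ) (κ : P.Key n) :
    SOp (R n).Basis (S n).Basis :=
  feed (P.pub n κ) ((A.circ n).sem (P.oracleMaps n κ))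

variable (P)

/-- Indistinguishability of encryptions (IND, IND-CPA, IND-CCA1). With `ρ = ρ_ME` the output of
`M`, the distinguisher receives `(Enc ⊗ 𝟙_E) ρ_ME` or `(Enc ⊗ 𝟙_E) (|0⟩⟨0| ⊗ ρ_E)`. -/
def IND (a : Attack) : Prop :=
  ∀ (E : RegFamily) (M : P.Generator a E.reg)
    (D : P.Party a (fun n => .qubits (P.ctLen n) ⊗ᵣ E.reg n) (fun _ => .qubits 1)),
    Negligible fun n =>
      |P.mean n (fun κ => probOne (D.run n κ
          (tensorId (P.enc n κ) (E.reg n).Basis (M.state n κ)))) -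
        P.mean n (fun κ => probOne (D.run n κ
          (tensorId (P.enc n κ) (E.reg n).Basis
            (ketbra (Reg.zero (.qubits (P.msgLen n))) ⊗ₖ traceFst (M.state n κ)))))|

/-- Semantic security (SEM, SEM-CPA, SEM-CCA1). With `ρ = ρ_MEF` the output of `M`, the
distinguisher receives `(A ⊗ 𝟙_F) (Enc ⊗ 𝟙_EF) ρ_MEF` or `(S ⊗ 𝟙_F) ρ_EF`. -/
def SEM (a : Attack) : Prop :=
  ∀ (E G : RegFamily) (A : P.Party a (fun n => .qubits (P.ctLen n) ⊗ᵣ E.reg n) G.reg),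
    ∃ S : P.Party a E.reg G.reg,
      ∀ (F : RegFamily) (M : P.Generator a (fun n => E.reg n ⊗ᵣ F.reg n))
        (D : P.Party a (fun n => G.reg n ⊗ᵣ F.reg n) (fun _ => .qubits 1)),
        Negligible fun n =>
          |P.mean n (fun κ => probOne (D.run n κ
              (tensorId (A.run n κ) (F.reg n).Basis
                (relabel (Equiv.prodAssoc _ _ _).symm
                  (tensorId (P.enc n κ) ((E.reg n).Basis × (F.reg n).Basis) (M.state n κ)))))) -
            P.mean n (fun κ => probOne (D.run n κ
              (tensorId (S.run n κ) (F.reg n).Basis (traceFst (M.state n κ)))))|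

end Setting

end QEnc

end

/-! The simulator replaces the ciphertext by an encryption of zero. From IND to SEM
(`Feasible.sem_of_ind`), it prepares such an encryption, places it next to `E` and runs the
adversary. The adversary followed by the SEM distinguisher is then an IND distinguisher with side
register `E ⊗ F`, and the two advantages are equal. From SEM to IND (`Feasible.ind_of_sem`), the
adversary merely forwards the ciphertext. Its simulator sees only what is left after tracing out the
plaintext, and this does not change when the plaintext is reset to zero. Both real games are
therefore close to one and the same ideal game, and the triangle inequality applies.

It remains to encrypt zero, which `Imitates` abstracts. Given the public key anyone can do so, and
given an encryption oracle one call suffices. In the private-key setting without oracles, the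
simulator generates a fresh key. Its output need not agree with an encryption under the actual key,
but no party depends on that key, so the game is linear in the ciphertext and only the average over
keys matters. The averages agree because the key probabilities sum to 1, which follows from trace
preservation of oracle-free circuits.

Every algorithm built on the way must be a uniform family. In prefix notation the code of a compound
circuit is a token followed by the codes of its parts, so it suffices that polynomial-time printing
is closed under concatenation (`Printable.append`) and covers constants and unary numerals. Two
printers are run in turn on disjoint stacks and their outputs joined. Running two parties in turn
also needs the public key twice; it is classical, so CNOT gates duplicate it. -/

open scoped Kronecker

noncomputable section

namespace QEnc

/-! ### Runs of stack machines -/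

open Turing StateTransition

/-- `f` leads from `a` to `b` in exactly `k` steps. -/
def RunsIn {σ : Type*} (f : σ → Option σ) (k : ℕ) (a b : σ) : Prop :=
  (flip bind f)^[k] (some a) = some b

section RunsIn

variable {σ : Type*} {f : σ → Option σ}

theorem RunsIn.refl (a : σ) : RunsIn f 0 a a := rfl

theorem RunsIn.head {a b c : σ} {k : ℕ} (h : f a = some b) (hk : RunsIn f k b c) :
    RunsIn f (k + 1) a c := by
  unfold RunsIn at *
  rw [Function.iterate_succ_apply]
  simpa [flip, h] using hk

theorem RunsIn.trans {a b c : σ} {k l : ℕ} (h : RunsIn f k a b) (h' : RunsIn f l b c) :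
    RunsIn f (k + l) a c := by
  unfold RunsIn at *
  rw [add_comm, Function.iterate_add_apply, h, h']

theorem RunsIn.exists_of_succ {a c : σ} {k : ℕ} (h : RunsIn f (k + 1) a c) :
    ∃ b, f a = some b ∧ RunsIn f k b c := by
  unfold RunsIn at *
  rw [Function.iterate_succ_apply] at h
  cases hb : f a with
  | some b => exact ⟨b, rfl, by simpa [flip, hb] using h⟩
  | none =>
    have hnone : ∀ j : ℕ, (flip bind f)^[j] (none : Option σ) = none := by
      intro j
      induction j with
      | zero => rfl
      | succ j ih => rw [Function.iterate_succ_apply]; exact ih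
    have : (flip bind f) (some a) = none := by simp [flip, hb]
    rw [this, hnone] at h
    exact absurd h (by simp)

end RunsIn

/-! ### Polynomial-time printing in terms of runs -/

/-- The stacks that are all empty except for `k`, which contains `s`. -/
def oneStack {K : Type} [DecidableEq K] {Γ : K → Type} (k : K) (s : List (Γ k)) :
    ∀ k, List (Γ k) :=
  Function.update (fun _ => []) k s

@[simp]
theorem oneStack_self {K : Type} [DecidableEq K] {Γ : K → Type} (k : K) (s : List (Γ k)) :
    oneStack k s k = s :=
  Function.update_self ..

theorem length_oneStack_le {K : Type} [DecidableEq K] {Γ : K → Type} (k k' : K)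
    (s : List (Γ k)) : (oneStack k s k').length ≤ s.length := by
  by_cases h : k' = k
  · subst h; simp
  · simp [oneStack, h]

theorem initList_eq (tm : FinTM2) (s : List (tm.Γ tm.k₀)) :
    initList tm s = ⟨some tm.main, tm.initialState, oneStack tm.k₀ s⟩ := by
  unfold initList oneStack
  congr 1
  funext k
  by_cases h : k = tm.k₀
  · subst h; simp
  · simp [h]

theorem haltList_eq (tm : FinTM2) (s : List (tm.Γ tm.k₁)) :
    haltList tm s = ⟨none, tm.initialState, oneStack tm.k₁ s⟩ := by
  unfold haltList oneStack
  congr 1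
  funext k
  by_cases h : k = tm.k₁
  · subst h; simp
  · simp [h]

theorem unaryEncodeNat_eq_replicate (n : ℕ) :
    Computability.unaryEncodeNat n = List.replicate n true := by
  induction n with
  | zero => rfl
  | succ n ih => rw [Computability.unaryEncodeNat, ih, List.replicate_succ]

theorem length_unaryEncodeNat (n : ℕ) : (Computability.unaryEncodeNat n).length = n := by
  rw [unaryEncodeNat_eq_replicate, List.length_replicate]

/-- A machine that prints `s n` on `1ⁿ` in polynomial time, as a statement about runs. -/
structure Printer (s : ℕ → List Tok) where
  tm : FinTM2
  inp : tm.Γ tm.k₀ ≃ Bool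
  out : tm.Γ tm.k₁ ≃ Tok
  time : Polynomial ℕ
  runs : ∀ n, ∃ k ≤ time.eval n, RunsIn (TM2.step tm.m) k
    ⟨some tm.main, tm.initialState, oneStack tm.k₀ (List.replicate n (inp.symm true))⟩
    ⟨none, tm.initialState, oneStack tm.k₁ ((s n).map out.symm)⟩

theorem Printable.exists_printer {s : ℕ → List Tok} (h : Printable s) : Nonempty (Printer s) := by
  obtain ⟨h⟩ := h
  refine ⟨⟨h.tm, h.inputAlphabet, h.outputAlphabet, h.time, fun n => ?_⟩⟩
  obtain ⟨⟨k, he⟩, hk⟩ := h.outputsFun n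
  rw [length_unaryEncodeNat] at hk
  refine ⟨k, hk, ?_⟩
  rw [Option.map_some, initList_eq, haltList_eq, unaryEncodeNat_eq_replicate,
    List.map_replicate] at he
  exact he

theorem Printer.printable {s : ℕ → List Tok} (p : Printer s) : Printable s := by
  refine ⟨⟨⟨p.tm, p.inp, p.out⟩, p.time, fun n => ?_⟩⟩
  have hr := p.runs n
  refine ⟨⟨hr.choose, ?_⟩, ?_⟩
  · have he := hr.choose_spec.2
    rw [Option.map_some, initList_eq, haltList_eq, unaryEncodeNat_eq_replicate,
      List.map_replicate]
    exact he
  · rw [length_unaryEncodeNat]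
    exact hr.choose_spec.1

/-! ### The growth of stacks -/

/-- The number of push instructions in a statement. -/
def pushCount {K : Type} {Γ : K → Type} {Λ σ : Type} : TM2.Stmt Γ Λ σ → ℕ
  | .push _ _ q => pushCount q + 1
  | .peek _ _ q => pushCount q
  | .pop _ _ q => pushCount q
  | .load _ q => pushCount q
  | .branch _ q₁ q₂ => pushCount q₁ + pushCount q₂
  | .goto _ => 0
  | .halt => 0

section Growth

variable {K : Type} [DecidableEq K] {Γ : K → Type} {Λ σ : Type}

/-- A step executes a single path through the statement, and only `push` lengthens a stack, by one
symbol. Counting both arms of every `branch` is wasteful but gives a bound independent of the state.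
-/
theorem length_stepAux_le (k : K) (q : TM2.Stmt Γ Λ σ) (v : σ) (S : ∀ k, List (Γ k)) :
    ((TM2.stepAux q v S).stk k).length ≤ (S k).length + pushCount q := by
  induction q generalizing v S with
  | push k' f q ih =>
    refine (ih _ _).trans ?_
    simp only [pushCount]
    by_cases h : k = k'
    · subst h; simp; omega
    · rw [Function.update_of_ne h]; omega
  | peek k' f q ih => exact ih _ _
  | pop k' f q ih =>
    refine (ih _ _).trans ?_
    simp only [pushCount]
    by_cases h : k = k'
    · subst h; simp
    · rw [Function.update_of_ne h]
  | load a q ih => exact ih _ _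
  | branch f q₁ q₂ ih₁ ih₂ =>
    have h₁ := ih₁ v S
    have h₂ := ih₂ v S
    simp only [pushCount, TM2.stepAux]
    cases f v <;> simp only [cond] <;> omega
  | goto f => simp [TM2.stepAux]
  | halt => simp [TM2.stepAux]

theorem length_le_of_runsIn [Fintype Λ] {m : Λ → TM2.Stmt Γ Λ σ} (k : K) {j : ℕ}
    {a b : TM2.Cfg Γ Λ σ} (h : RunsIn (TM2.step m) j a b) :
    (b.stk k).length ≤ (a.stk k).length + (∑ l, pushCount (m l)) * j := by
  induction j generalizing a with
  | zero =>
    have : a = b := Option.some.inj h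
    rw [this]; simp
  | succ j ih =>
    obtain ⟨a', ha', h'⟩ := h.exists_of_succ
    have h₁ := ih h'
    obtain ⟨l, v, S⟩ := a
    cases l with
    | none => simp at ha'
    | some l =>
      simp only [TM2.step, Option.some.injEq] at ha'
      subst ha'
      have h₂ := length_stepAux_le k (m l) v S
      have h₃ : pushCount (m l) ≤ ∑ l, pushCount (m l) :=
        Finset.single_le_sum (f := fun l => pushCount (m l)) (fun _ _ => Nat.zero_le _)
          (Finset.mem_univ l)
      rw [Nat.mul_succ]
      simp only at *
      omega

end Growth

/-- A machine prints no more than it has had time to push. The bound is needed because concatenation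
moves one of the outputs symbol by symbol. -/
theorem Printer.length_le {s : ℕ → List Tok} (p : Printer s) :
    ∃ q : Polynomial ℕ, ∀ n, (s n).length ≤ q.eval n := by
  let := p.tm.ΛFin
  -- The summand `X` covers the case in which the input stack is also the output stack.
  refine ⟨Polynomial.X + Polynomial.C (∑ l, pushCount (p.tm.m l)) * p.time, fun n => ?_⟩
  obtain ⟨k, hk, hr⟩ := p.runs n
  have h := length_le_of_runsIn p.tm.k₁ hr
  simp only [oneStack_self, List.length_map] at h
  have h' := length_oneStack_le p.tm.k₀ p.tm.k₁ (List.replicate n (p.inp.symm true))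
  rw [List.length_replicate] at h'
  simp only [Polynomial.eval_add, Polynomial.eval_X, Polynomial.eval_mul, Polynomial.eval_C]
  exact h.trans (Nat.add_le_add h' (Nat.mul_le_mul_left _ hk))

/-! ### Printing a unary numeral -/

/-- The stacks of `unaryPrinter`: the input, and the output. -/
abbrev unaryPrinterΓ : Bool → Type
  | false => Bool
  | true => Tok

/-- The program of `unaryPrinter`. -/
def unaryPrinterProg (w : List Tok) (b : Tok) :
    Bool → TM2.Stmt unaryPrinterΓ Bool (Option Bool)
  | false => .push true (fun _ => b) (.goto fun _ => true)
  | true => .pop false (fun _ x => x)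
      (.branch Option.isSome
        (w.foldr (fun a q => .push true (fun _ => a) q) (.goto fun _ => true)) .halt)

/-- The machine that prints `b` after `n` copies of the word `w`, read backwards. -/
def unaryPrinter (w : List Tok) (b : Tok) : FinTM2 where
  K := Bool
  k₀ := false
  k₁ := true
  Γ := unaryPrinterΓ
  Λ := Bool
  main := false
  σ := Option Bool
  initialState := none
  Γk₀Fin := inferInstanceAs (Fintype Bool)
  m := unaryPrinterProg w b

/-- The stacks of `unaryPrinter` with given contents. -/
def unaryPrinterStk (I : List Bool) (O : List Tok) : ∀ k, List (unaryPrinterΓ k)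
  | false => I
  | true => O

@[simp]
theorem update_unaryPrinterStk_false (I I' : List Bool) (O : List Tok) :
    Function.update (unaryPrinterStk I O) false I' = unaryPrinterStk I' O := by
  funext k; cases k <;> rfl

@[simp]
theorem update_unaryPrinterStk_true (I : List Bool) (O O' : List Tok) :
    Function.update (unaryPrinterStk I O) true O' = unaryPrinterStk I O' := by
  funext k; cases k <;> rfl

theorem stepAux_foldr_push (w : List Tok) (v : Option Bool) (I : List Bool) (O : List Tok) :
    TM2.stepAux (w.foldr (fun a q => .push true (fun _ => a) q)
      (.goto fun _ => true) : TM2.Stmt unaryPrinterΓ Bool (Option Bool)) v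
      (unaryPrinterStk I O) = ⟨some true, v, unaryPrinterStk I (w.reverse ++ O)⟩ := by
  induction w generalizing O with
  | nil => rfl
  | cons a w ih =>
    simp only [List.foldr_cons, TM2.stepAux]
    have : (unaryPrinterStk I O true) = O := rfl
    rw [this, update_unaryPrinterStk_true, ih]
    simp

theorem unaryPrinter_loop (w : List Tok) (b : Tok) (v : Option Bool) (O : List Tok) (n : ℕ) :
    RunsIn (TM2.step (unaryPrinterProg w b)) (n + 1)
      ⟨some true, v, unaryPrinterStk (List.replicate n true) O⟩
      ⟨none, none, unaryPrinterStk [] ((List.replicate n w.reverse).flatten ++ O)⟩ := by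
  induction n generalizing v O with
  | zero =>
    refine RunsIn.head ?_ (RunsIn.refl _)
    simp only [TM2.step, unaryPrinterProg, TM2.stepAux]
    rw [update_unaryPrinterStk_false]
    rfl
  | succ n ih =>
    refine RunsIn.head (b := ⟨some true, some true,
      unaryPrinterStk (List.replicate n true) (w.reverse ++ O)⟩) ?_ ?_
    · simp only [TM2.step, unaryPrinterProg, TM2.stepAux]
      rw [update_unaryPrinterStk_false, stepAux_foldr_push]
      rfl
    · have := ih (some true) (w.reverse ++ O)
      rw [← List.append_assoc, show (List.replicate n w.reverse).flatten ++ w.reverse =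
        (List.replicate (n + 1) w.reverse).flatten by
          rw [List.replicate_succ']; simp] at this
      exact this

/-- The token `b` is pushed first and so comes last in the output; each input symbol then pushes
`w`, which reverses it. The empty word yields constants, and the word `[mark]` yields unary
numerals. -/
theorem Printable.replicate_flatten_append (w : List Tok) (b : Tok) :
    Printable fun n => (List.replicate n w.reverse).flatten ++ [b] := by
  -- One step for `b`, one per input symbol, and one to find the input exhausted. That last pop also
  -- resets the internal state to `none`, as the halting configuration demands.
  refine Printer.printable ⟨unaryPrinter w b, Equiv.refl _, Equiv.refl _,
    Polynomial.X + 2, fun n => ⟨n + 1 + 1, ?_, ?_⟩⟩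
  · simp
  · refine RunsIn.head
      (b := ⟨some true, none, unaryPrinterStk (List.replicate n true) [b]⟩) ?_ ?_
    · change some _ = _
      refine congrArg some ?_
      simp only [unaryPrinter, unaryPrinterProg, TM2.stepAux]
      congr 1
      funext k; cases k <;> rfl
    · have h := unaryPrinter_loop w b none [b] n
      have e : unaryPrinterStk [] ((List.replicate n w.reverse).flatten ++ [b]) =
          oneStack (Γ := unaryPrinterΓ) true
            (((List.replicate n w.reverse).flatten ++ [b]).map (Equiv.refl Tok).symm) := by
        funext k
        cases k
        · rfl
        · exact (List.map_id _).symm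
      rw [e] at h
      exact h

theorem Printable.singleton (b : Tok) : Printable fun _ => [b] := by
  have h := Printable.replicate_flatten_append [] b
  simpa using h

theorem Printable.qubitsCode : Printable fun n => qubitsCode n := by
  have h := Printable.replicate_flatten_append [Tok.mark] Tok.qubits
  simpa [QEnc.qubitsCode] using h

/-! ### Concatenation of printers -/

/-- The phases of `appendMachine` in which neither of the two printers is running. -/
inductive AppendPhase : Type
  | copy | unload | load
  deriving DecidableEq

instance : Fintype AppendPhase :=
  Fintype.ofList [.copy, .unload, .load] fun x => by cases x <;> simp

instance (tm : FinTM2) : Fintype tm.K := tm.kFin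
instance (tm : FinTM2) : Fintype tm.Λ := tm.ΛFin
instance (tm : FinTM2) : Fintype tm.σ := tm.σFin

section Append

variable (tm : Bool → FinTM2)

/-- The names of the stacks of `appendMachine`: those of the two printers, an input stack `false`,
and a buffer `true`. -/
abbrev AppendK : Type := (Σ b, (tm b).K) ⊕ Bool

/-- The stack alphabets of `appendMachine`. -/
abbrev AppendΓ : AppendK tm → Type
  | .inl p => (tm p.1).Γ p.2
  | .inr false => Bool
  | .inr true => Tok

/-- The labels of `appendMachine`. -/
abbrev AppendΛ : Type := (Σ b, (tm b).Λ) ⊕ AppendPhase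

/-- The internal states of `appendMachine`. -/
abbrev Appendσ : Type := (∀ b, (tm b).σ) × Option Bool × Option Tok

/-- The stacks of `appendMachine` with given contents. -/
def appendStk (S : ∀ b k, List ((tm b).Γ k)) (I : List Bool) (T : List Tok) :
    ∀ k, List (AppendΓ tm k)
  | .inl p => S p.1 p.2
  | .inr false => I
  | .inr true => T

variable {tm}

theorem update_appendStk_inl (S : ∀ b k, List ((tm b).Γ k)) (I : List Bool) (T : List Tok)
    (b : Bool) (k : (tm b).K) (s : List ((tm b).Γ k)) :
    Function.update (appendStk tm S I T) (.inl ⟨b, k⟩) s =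
      appendStk tm (Function.update S b (Function.update (S b) k s)) I T := by
  funext p
  rcases p with ⟨b', k'⟩ | p
  · by_cases hb : b' = b
    · subst hb
      by_cases hk : k' = k
      · subst hk; simp [appendStk]
      · rw [Function.update_of_ne (by simpa using hk)]
        simp [appendStk, hk]
    · rw [Function.update_of_ne (by rintro h; cases h; exact hb rfl)]
      simp [appendStk, hb]
  · rw [Function.update_of_ne (by simp)]
    cases p <;> rfl

theorem update_appendStk_false (S : ∀ b k, List ((tm b).Γ k)) (I I' : List Bool)
    (T : List Tok) :
    Function.update (appendStk tm S I T) (.inr false) I' = appendStk tm S I' T := by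
  funext p
  rcases p with p | p
  · rfl
  · cases p <;> rfl

theorem update_appendStk_true (S : ∀ b k, List ((tm b).Γ k)) (I : List Bool)
    (T T' : List Tok) :
    Function.update (appendStk tm S I T) (.inr true) T' = appendStk tm S I T' := by
  funext p
  rcases p with p | p
  · rfl
  · cases p <;> rfl

/-- A statement of the printer `b` as a statement of `appendMachine`; halting is replaced by a jump
to the label `e`. -/
def liftStmt (b : Bool) (e : AppendΛ tm) :
    TM2.Stmt (tm b).Γ (tm b).Λ (tm b).σ → TM2.Stmt (AppendΓ tm) (AppendΛ tm) (Appendσ tm)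
  | .push k f q => .push (.inl ⟨b, k⟩) (fun v => f (v.1 b)) (liftStmt b e q)
  | .peek k f q => .peek (.inl ⟨b, k⟩)
      (fun v x => (Function.update v.1 b (f (v.1 b) x), v.2)) (liftStmt b e q)
  | .pop k f q => .pop (.inl ⟨b, k⟩)
      (fun v x => (Function.update v.1 b (f (v.1 b) x), v.2)) (liftStmt b e q)
  | .load f q => .load (fun v => (Function.update v.1 b (f (v.1 b)), v.2)) (liftStmt b e q)
  | .branch f q₁ q₂ => .branch (fun v => f (v.1 b)) (liftStmt b e q₁) (liftStmt b e q₂)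
  | .goto f => .goto fun v => .inl ⟨b, f (v.1 b)⟩
  | .halt => .goto fun _ => e

/-- A configuration of the printer `b` as a configuration of `appendMachine`. -/
def liftCfg (b : Bool) (e : AppendΛ tm) (V : Appendσ tm) (S : ∀ b k, List ((tm b).Γ k))
    (I : List Bool) (T : List Tok) (c : TM2.Cfg (tm b).Γ (tm b).Λ (tm b).σ) :
    TM2.Cfg (AppendΓ tm) (AppendΛ tm) (Appendσ tm) where
  l := some (c.l.elim e fun l => .inl ⟨b, l⟩)
  var := (Function.update V.1 b c.var, V.2)
  stk := appendStk tm (Function.update S b c.stk) I T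

/-- A lifted statement reads and writes only the component `b` of the state and of the stacks, so it
commutes with the embedding of configurations. -/
theorem stepAux_liftStmt (b : Bool) (e : AppendΛ tm) (V : Appendσ tm)
    (S : ∀ b k, List ((tm b).Γ k)) (I : List Bool) (T : List Tok)
    (q : TM2.Stmt (tm b).Γ (tm b).Λ (tm b).σ) (v : (tm b).σ) (R : ∀ k, List ((tm b).Γ k)) :
    TM2.stepAux (liftStmt b e q) (Function.update V.1 b v, V.2)
      (appendStk tm (Function.update S b R) I T) =
      liftCfg b e V S I T (TM2.stepAux q v R) := by
  have hget : ∀ (R : ∀ k, List ((tm b).Γ k)) (k : (tm b).K),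
      appendStk tm (Function.update S b R) I T (.inl ⟨b, k⟩) = R k := fun R k => by
    simp [appendStk]
  induction q generalizing v R with
  | push k f q ih =>
    simp only [liftStmt, TM2.stepAux, update_appendStk_inl, hget, Function.update_self,
      Function.update_idem]
    exact ih _ _
  | peek k f q ih =>
    simp only [liftStmt, TM2.stepAux, hget, Function.update_self, Function.update_idem]
    exact ih _ _
  | pop k f q ih =>
    simp only [liftStmt, TM2.stepAux, update_appendStk_inl, hget, Function.update_self,
      Function.update_idem]
    exact ih _ _
  | load f q ih =>
    simp only [liftStmt, TM2.stepAux, Function.update_self, Function.update_idem]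
    exact ih _ _
  | branch f q₁ q₂ ih₁ ih₂ =>
    simp only [liftStmt, TM2.stepAux, Function.update_self]
    cases f v
    · exact ih₂ _ _
    · exact ih₁ _ _
  | goto f => simp [liftStmt, TM2.stepAux, liftCfg]
  | halt => simp [liftStmt, TM2.stepAux, liftCfg]

/-- Halting becomes a jump to `e` inside the same step, so the simulation takes exactly as many
steps as the original run and ends ready for the next phase. -/
theorem runsIn_liftCfg (b : Bool) (e : AppendΛ tm) (V : Appendσ tm)
    (S : ∀ b k, List ((tm b).Γ k)) (I : List Bool) (T : List Tok)
    {m : AppendΛ tm → TM2.Stmt (AppendΓ tm) (AppendΛ tm) (Appendσ tm)}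
    (hm : ∀ l, m (.inl ⟨b, l⟩) = liftStmt b e ((tm b).m l)) {k : ℕ}
    {c d : TM2.Cfg (tm b).Γ (tm b).Λ (tm b).σ} (h : RunsIn (TM2.step (tm b).m) k c d) :
    RunsIn (TM2.step m) k (liftCfg b e V S I T c) (liftCfg b e V S I T d) := by
  induction k generalizing c with
  | zero => rw [show c = d from Option.some.inj h]; exact RunsIn.refl _
  | succ k ih =>
    obtain ⟨c', hc, h'⟩ := h.exists_of_succ
    refine RunsIn.head ?_ (ih h')
    obtain ⟨l, v, R⟩ := c
    cases l with
    | none => simp at hc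
    | some l =>
      simp only [TM2.step, Option.some.injEq] at hc
      subst hc
      rw [← stepAux_liftStmt, ← hm]
      rfl

end Append

/-! ### The machine that runs two printers in turn -/

variable {s : Bool → ℕ → List Tok} (p : ∀ b, Printer (s b))

/-- The program of `appendMachine`: copy the input to both printers, run the printer `true`, run the
printer `false`, and move the output of the latter onto the output of the former. -/
def appendProg : AppendΛ (fun b => (p b).tm) →
    TM2.Stmt (AppendΓ fun b => (p b).tm) (AppendΛ fun b => (p b).tm) (Appendσ fun b => (p b).tm)
  | .inl ⟨true, l⟩ => liftStmt (tm := fun b => (p b).tm) true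
      (.inl ⟨false, (p false).tm.main⟩) ((p true).tm.m l)
  | .inl ⟨false, l⟩ => liftStmt (tm := fun b => (p b).tm) false (.inr .unload) ((p false).tm.m l)
  | .inr .copy => .pop (.inr false) (fun v x => (v.1, x, v.2.2))
      (.branch (fun v => v.2.1.isSome)
        (.push (.inl ⟨true, (p true).tm.k₀⟩) (fun v => (p true).inp.symm (v.2.1.getD true))
          (.push (.inl ⟨false, (p false).tm.k₀⟩) (fun v => (p false).inp.symm (v.2.1.getD true))
            (.goto fun _ => .inr .copy)))
        (.goto fun _ => .inl ⟨true, (p true).tm.main⟩))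
  | .inr .unload => .pop (.inl ⟨false, (p false).tm.k₁⟩)
      (fun v x => (v.1, v.2.1, x.map (p false).out))
      (.branch (fun v => v.2.2.isSome)
        (.push (.inr true) (fun v => v.2.2.getD .mark) (.goto fun _ => .inr .unload))
        (.goto fun _ => .inr .load))
  | .inr .load => .pop (.inr true) (fun v x => (v.1, v.2.1, x))
      (.branch (fun v => v.2.2.isSome)
        (.push (.inl ⟨true, (p true).tm.k₁⟩) (fun v => (p true).out.symm (v.2.2.getD .mark))
          (.goto fun _ => .inr .load))
        .halt)

/-- The machine that prints `s false n ++ s true n`. -/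
def appendMachine : FinTM2 where
  K := AppendK fun b => (p b).tm
  k₀ := .inr false
  k₁ := .inl ⟨true, (p true).tm.k₁⟩
  Γ := AppendΓ fun b => (p b).tm
  Λ := AppendΛ fun b => (p b).tm
  main := .inr .copy
  σ := Appendσ fun b => (p b).tm
  initialState := (fun b => (p b).tm.initialState, none, none)
  Γk₀Fin := inferInstanceAs (Fintype Bool)
  m := appendProg p

/-- A pair of stacks, one for each printer. -/
def bothStk (R₀ : ∀ k, List ((p false).tm.Γ k)) (R₁ : ∀ k, List ((p true).tm.Γ k)) :
    ∀ b k, List ((p b).tm.Γ k)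
  | false => R₀
  | true => R₁

variable (R₀ R₀' : ∀ k, List ((p false).tm.Γ k)) (R₁ R₁' : ∀ k, List ((p true).tm.Γ k))

theorem update_bothStk_false :
    Function.update (bothStk p R₀ R₁) false R₀' = bothStk p R₀' R₁ := by
  funext b; cases b <;> rfl

theorem update_bothStk_true :
    Function.update (bothStk p R₀ R₁) true R₁' = bothStk p R₀ R₁' := by
  funext b; cases b <;> rfl

theorem update_oneStack {K : Type} [DecidableEq K] {Γ : K → Type} (k : K) (s s' : List (Γ k)) :
    Function.update (oneStack k s) k s' = oneStack k s' :=
  Function.update_idem ..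

section AppendRuns

variable {s : Bool → ℕ → List Tok} (p : ∀ b, Printer (s b))

/-- A configuration of `appendMachine`. -/
def appendCfg (l : Option (AppendΛ fun b => (p b).tm)) (x : Option Bool) (y : Option Tok)
    (R₀ : ∀ k, List ((p false).tm.Γ k)) (R₁ : ∀ k, List ((p true).tm.Γ k)) (I : List Bool)
    (T : List Tok) :
    TM2.Cfg (AppendΓ fun b => (p b).tm) (AppendΛ fun b => (p b).tm) (Appendσ fun b => (p b).tm) :=
  ⟨l, (fun b => (p b).tm.initialState, x, y),
    appendStk (tm := fun b => (p b).tm) (bothStk p R₀ R₁) I T⟩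

/-- Here `j` counts the symbols already copied; it must vary for the induction on the `n` symbols
left. The extra step finds the input empty. -/
theorem appendProg_copy (x : Option Bool) (y : Option Tok) (j n : ℕ) :
    RunsIn (TM2.step (appendProg p)) (n + 1)
      (appendCfg p (some (.inr .copy)) x y
        (oneStack (p false).tm.k₀ (List.replicate j ((p false).inp.symm true)))
        (oneStack (p true).tm.k₀ (List.replicate j ((p true).inp.symm true)))
        (List.replicate n true) [])
      (appendCfg p (some (.inl ⟨true, (p true).tm.main⟩)) none y
        (oneStack (p false).tm.k₀ (List.replicate (j + n) ((p false).inp.symm true)))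
        (oneStack (p true).tm.k₀ (List.replicate (j + n) ((p true).inp.symm true))) [] []) := by
  induction n generalizing j x with
  | zero =>
    refine RunsIn.head ?_ (RunsIn.refl _)
    simp only [TM2.step, appendProg, appendCfg, TM2.stepAux, update_appendStk_false]
    rfl
  | succ n ih =>
    refine RunsIn.head ?_ (Nat.add_right_comm j n 1 ▸ ih (some true) (j + 1))
    simp only [TM2.step, appendProg, appendCfg, TM2.stepAux, update_appendStk_false,
      update_appendStk_inl]
    simp only [appendStk, List.replicate_succ, List.head?_cons, Option.isSome_some, cond,
      List.tail_cons, Option.getD_some, bothStk, update_bothStk_true, update_bothStk_false,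
      oneStack_self, update_oneStack, ne_eq, not_false_eq_true,
      Function.update_of_ne, Bool.false_eq_true]

/-- Moving a stack reverses it. The passage through the buffer, here and in `appendProg_load`,
reverses twice and so restores the order; as the head of a list is the top of its stack, the word
loaded last stands in front. -/
theorem appendProg_unload (x : Option Bool) (y : Option Tok) (w T : List Tok)
    (R₁ : ∀ k, List ((p true).tm.Γ k)) :
    RunsIn (TM2.step (appendProg p)) (w.length + 1)
      (appendCfg p (some (.inr .unload)) x y
        (oneStack (p false).tm.k₁ (w.map (p false).out.symm)) R₁ [] T)
      (appendCfg p (some (.inr .load)) x none (oneStack (p false).tm.k₁ []) R₁ []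
        (w.reverse ++ T)) := by
  induction w generalizing y T with
  | nil =>
    refine RunsIn.head ?_ (RunsIn.refl _)
    simp only [TM2.step, appendProg, appendCfg, TM2.stepAux, update_appendStk_inl]
    simp only [appendStk, bothStk, update_bothStk_false, oneStack_self, update_oneStack]
    rfl
  | cons a w ih =>
    refine RunsIn.head ?_ ((List.reverse_cons (a := a) (as := w) ▸
      List.append_assoc w.reverse [a] T ▸ ih (some a) (a :: T)))
    simp only [TM2.step, appendProg, appendCfg, TM2.stepAux, update_appendStk_inl,
      update_appendStk_true]
    simp only [appendStk, bothStk, update_bothStk_false, oneStack_self, update_oneStack,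
      List.map_cons, List.head?_cons, Option.map_some, Equiv.apply_symm_apply,
      Option.isSome_some, cond, List.tail_cons, Option.getD_some]

theorem appendProg_load (x : Option Bool) (y : Option Tok) (w o : List Tok)
    (R₀ : ∀ k, List ((p false).tm.Γ k)) :
    RunsIn (TM2.step (appendProg p)) (w.length + 1)
      (appendCfg p (some (.inr .load)) x y R₀
        (oneStack (p true).tm.k₁ (o.map (p true).out.symm)) [] w)
      (appendCfg p none x none R₀
        (oneStack (p true).tm.k₁ ((w.reverse ++ o).map (p true).out.symm)) [] []) := by
  induction w generalizing y o with
  | nil =>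
    refine RunsIn.head ?_ (RunsIn.refl _)
    simp only [TM2.step, appendProg, appendCfg, TM2.stepAux, update_appendStk_true]
    rfl
  | cons a w ih =>
    refine RunsIn.head ?_ ((List.reverse_cons (a := a) (as := w) ▸
      List.append_assoc w.reverse [a] o ▸ ih (some a) (a :: o)))
    simp only [TM2.step, appendProg, appendCfg, TM2.stepAux, update_appendStk_inl,
      update_appendStk_true]
    simp only [appendStk, bothStk, update_bothStk_true, oneStack_self, update_oneStack,
      List.map_cons, List.head?_cons,
      Option.isSome_some, cond, List.tail_cons, Option.getD_some]

/-- The embedding overwrites the stacks of the running printer, so `R₁'` is arbitrary. The internal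
states match because a printer both starts and halts in its initial state. -/
theorem appendCfg_eq_liftCfg_true (e : AppendΛ fun b => (p b).tm) (l : Option (p true).tm.Λ)
    (R₀ : ∀ k, List ((p false).tm.Γ k)) (R₁ R₁' : ∀ k, List ((p true).tm.Γ k)) :
    liftCfg (tm := fun b => (p b).tm) true e (fun b => (p b).tm.initialState, none, none)
      (bothStk p R₀ R₁') [] [] ⟨l, (p true).tm.initialState, R₁⟩ =
    appendCfg p (some (l.elim e fun l => .inl ⟨true, l⟩)) none none R₀ R₁ [] [] := by
  simp only [liftCfg, appendCfg, Function.update_eq_self, update_bothStk_true]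

theorem appendCfg_eq_liftCfg_false (e : AppendΛ fun b => (p b).tm) (l : Option (p false).tm.Λ)
    (R₀ R₀' : ∀ k, List ((p false).tm.Γ k)) (R₁ : ∀ k, List ((p true).tm.Γ k)) :
    liftCfg (tm := fun b => (p b).tm) false e (fun b => (p b).tm.initialState, none, none)
      (bothStk p R₀' R₁) [] [] ⟨l, (p false).tm.initialState, R₀⟩ =
    appendCfg p (some (l.elim e fun l => .inl ⟨false, l⟩)) none none R₀ R₁ [] [] := by
  simp only [liftCfg, appendCfg, Function.update_eq_self, update_bothStk_false]

theorem appendProg_runs (n : ℕ) : ∃ k₁ ≤ (p true).time.eval n, ∃ k₀ ≤ (p false).time.eval n,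
    RunsIn (TM2.step (appendProg p))
      (n + 1 + k₁ + k₀ + ((s false n).length + 1) + ((s false n).length + 1))
      (appendCfg p (some (.inr .copy)) none none (oneStack (p false).tm.k₀ [])
        (oneStack (p true).tm.k₀ []) (List.replicate n true) [])
      (appendCfg p none none none (oneStack (p false).tm.k₁ [])
        (oneStack (p true).tm.k₁ ((s false n ++ s true n).map (p true).out.symm)) [] []) := by
  obtain ⟨k₁, hk₁, h₁⟩ := (p true).runs n
  obtain ⟨k₀, hk₀, h₀⟩ := (p false).runs n
  refine ⟨k₁, hk₁, k₀, hk₀, ?_⟩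
  have r₁ := runsIn_liftCfg (tm := fun b => (p b).tm) true (.inl ⟨false, (p false).tm.main⟩)
    (fun b => (p b).tm.initialState, none, none)
    (bothStk p (oneStack (p false).tm.k₀ (List.replicate n ((p false).inp.symm true)))
      (oneStack (p true).tm.k₀ [])) [] [] (m := appendProg p) (fun _ => rfl) h₁
  have r₀ := runsIn_liftCfg (tm := fun b => (p b).tm) false (.inr .unload)
    (fun b => (p b).tm.initialState, none, none)
    (bothStk p (oneStack (p false).tm.k₀ [])
      (oneStack (p true).tm.k₁ ((s true n).map (p true).out.symm))) [] [] (m := appendProg p)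
    (fun _ => rfl) h₀
  rw [appendCfg_eq_liftCfg_true, appendCfg_eq_liftCfg_true] at r₁
  rw [appendCfg_eq_liftCfg_false, appendCfg_eq_liftCfg_false] at r₀
  have rc := appendProg_copy p none none 0 n
  rw [Nat.zero_add] at rc
  have ru := appendProg_unload p none none (s false n) []
    (oneStack (p true).tm.k₁ ((s true n).map (p true).out.symm))
  have rl := appendProg_load p none none (s false n).reverse (s true n)
    (oneStack (p false).tm.k₁ [])
  rw [List.append_nil] at ru
  rw [List.reverse_reverse, List.length_reverse] at rl
  exact (((rc.trans r₁).trans r₀).trans ru).trans rl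

end AppendRuns

theorem appendStk_eq_oneStack_inr {s : Bool → ℕ → List Tok} (p : ∀ b, Printer (s b))
    (I : List Bool) :
    appendStk (tm := fun b => (p b).tm) (bothStk p (oneStack (p false).tm.k₀ [])
      (oneStack (p true).tm.k₀ [])) I [] =
    oneStack (Γ := AppendΓ fun b => (p b).tm) (.inr false) I := by
  funext k
  rcases k with ⟨b, k⟩ | b
  · cases b <;> simp [appendStk, bothStk, oneStack]
  · cases b <;> simp [appendStk, oneStack]

theorem appendStk_eq_oneStack_inl {s : Bool → ℕ → List Tok} (p : ∀ b, Printer (s b))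
    (o : List ((p true).tm.Γ (p true).tm.k₁)) :
    appendStk (tm := fun b => (p b).tm) (bothStk p (oneStack (p false).tm.k₁ [])
      (oneStack (p true).tm.k₁ o)) [] [] =
    oneStack (Γ := AppendΓ fun b => (p b).tm) (.inl ⟨true, (p true).tm.k₁⟩) o := by
  have h : (fun _ => [] : ∀ k, List (AppendΓ (fun b => (p b).tm) k)) =
      appendStk (tm := fun b => (p b).tm) (bothStk p (oneStack (p false).tm.k₁ [])
        (oneStack (p true).tm.k₁ [])) [] [] := by
    funext k
    rcases k with ⟨b, k⟩ | b
    · cases b <;> simp [appendStk, bothStk, oneStack]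
    · cases b <;> simp [appendStk]
  unfold oneStack
  rw [h, update_appendStk_inl, update_bothStk_true]
  simp [bothStk, oneStack]

/-- The concatenation of two printers. -/
theorem nonempty_printer_append {s : Bool → ℕ → List Tok} (p : ∀ b, Printer (s b)) :
    Nonempty (Printer fun n => s false n ++ s true n) := by
  obtain ⟨q, hq⟩ := (p false).length_le
  refine ⟨⟨appendMachine p, Equiv.refl _, (p true).out,
    Polynomial.X + 1 + (p true).time + (p false).time + (q + 1) + (q + 1), fun n => ?_⟩⟩
  obtain ⟨k₁, hk₁, k₀, hk₀, h⟩ := appendProg_runs p n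
  refine ⟨n + 1 + k₁ + k₀ + ((s false n).length + 1) + ((s false n).length + 1), ?_, ?_⟩
  · have := hq n
    simp only [Polynomial.eval_add, Polynomial.eval_X, Polynomial.eval_one]
    omega
  · simp only [appendCfg] at h
    rw [appendStk_eq_oneStack_inr, appendStk_eq_oneStack_inl] at h
    exact h

theorem Printable.append {s t : ℕ → List Tok} (hs : Printable s) (ht : Printable t) :
    Printable fun n => s n ++ t n := by
  obtain ⟨ps⟩ := hs.exists_printer
  obtain ⟨pt⟩ := ht.exists_printer
  obtain ⟨p⟩ := nonempty_printer_append (s := fun b => if b then t else s) fun b =>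
    match b with
    | true => pt
    | false => ps
  exact p.printable

theorem Printable.cons (a : Tok) {s : ℕ → List Tok} (hs : Printable s) :
    Printable fun n => a :: s n :=
  (Printable.singleton a).append hs

/-! ### Identities for maps on operators -/

section Maps

variable {A B C D : Type}

theorem tensorId_apply (Φ : SOp A B) (X : Matrix (A × C) (A × C) ℂ) (b b' : B) (c c' : C) :
    tensorId Φ C X (b, c) (b', c') = Φ (Matrix.of fun a a' => X (a, c) (a', c')) b b' := rfl

/-- Each block of `X ⊗ₖ Y` over the second factor is a scalar multiple of `X`, and `Φ` is linear. -/
theorem tensorId_kronecker (Φ : SOp A B) (X : Matrix A A ℂ) (Y : Matrix C C ℂ) :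
    tensorId Φ C (X ⊗ₖ Y) = Φ X ⊗ₖ Y := by
  ext ⟨b, c⟩ ⟨b', c'⟩
  rw [tensorId_apply]
  have h : (Matrix.of fun a a' => (X ⊗ₖ Y) (a, c) (a', c')) = Y c c' • X := by
    ext a a'
    simp [mul_comm]
  rw [h, map_smul]
  simp [mul_comm]

theorem relabel_apply (e : A ≃ B) (X : Matrix A A ℂ) (b b' : B) :
    relabel e X b b' = X (e.symm b) (e.symm b') := rfl

theorem relabel_ketbra [DecidableEq A] [DecidableEq B] (e : A ≃ B) (x : A) :
    relabel e (ketbra x) = ketbra (e x) := by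
  ext b b'
  simp only [relabel_apply, ketbra, Matrix.single_apply, Equiv.eq_symm_apply]

theorem relabel_prodComm_kronecker (X : Matrix A A ℂ) (Y : Matrix B B ℂ) :
    relabel (Equiv.prodComm A B) (X ⊗ₖ Y) = Y ⊗ₖ X := by
  ext ⟨b, a⟩ ⟨b', a'⟩
  simp [relabel_apply, mul_comm]

theorem relabel_prodAssoc_kronecker (X : Matrix A A ℂ) (Y : Matrix B B ℂ) (Z : Matrix C C ℂ) :
    relabel (Equiv.prodAssoc A B C) ((X ⊗ₖ Y) ⊗ₖ Z) = X ⊗ₖ (Y ⊗ₖ Z) := by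
  ext ⟨a, b, c⟩ ⟨a', b', c'⟩
  simp [relabel_apply, mul_assoc]

theorem ketbra_kronecker_ketbra [DecidableEq A] [DecidableEq B] (x : A) (y : B) :
    ketbra x ⊗ₖ ketbra y = ketbra (x, y) := by
  simp [ketbra, Matrix.single_kronecker_single]

theorem ketbra_eq_one [DecidableEq A] [Unique A] (x : A) : ketbra x = 1 := by
  ext a a'
  rw [Subsingleton.elim a' a, Subsingleton.elim x a, Matrix.one_apply_eq]
  simp [ketbra]

theorem relabel_uniqueProd_ketbra [DecidableEq A] [Unique A] (x : A) (X : Matrix B B ℂ) :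
    relabel (Equiv.uniqueProd B A) (ketbra x ⊗ₖ X) = X := by
  ext b b'
  simp [relabel_apply, ketbra_eq_one]

theorem relabel_uniqueProd_symm [DecidableEq A] [Unique A] (x : A) (X : Matrix B B ℂ) :
    relabel (Equiv.uniqueProd B A).symm X = ketbra x ⊗ₖ X := by
  ext ⟨a, b⟩ ⟨a', b'⟩
  simp [relabel_apply, ketbra_eq_one, Subsingleton.elim a a']

theorem trace_ketbra [Fintype A] [DecidableEq A] (x : A) : (ketbra x).trace = 1 := by
  simp [ketbra]

theorem replaceBy_ketbra [Fintype A] [DecidableEq A] [DecidableEq B] (x : A) (y : B) :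
    replaceBy y (ketbra x) = ketbra y := by
  change (ketbra x).trace • ketbra y = _
  rw [trace_ketbra, one_smul]

theorem traceFst_kronecker [Fintype A] (X : Matrix A A ℂ) (Y : Matrix B B ℂ) :
    traceFst (X ⊗ₖ Y) = X.trace • Y := by
  ext b b'
  simp [traceFst, Matrix.trace, Finset.sum_mul]

theorem tensorId_replaceBy [Fintype A] [DecidableEq B] (y : B)
    (X : Matrix (A × C) (A × C) ℂ) :
    tensorId (replaceBy y) C X = ketbra y ⊗ₖ traceFst X := by
  ext ⟨b, c⟩ ⟨b', c'⟩
  rw [tensorId_apply]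
  change ((Matrix.of fun a a' => X (a, c) (a', c')).trace • ketbra y) b b' = _
  simp [traceFst, Matrix.trace, mul_comm]

/-- This form exhibits a measured register as a mixture of classical values, to which linearity can
be applied; it is used for the freshly generated key. -/
theorem dephase_eq_sum [Fintype A] [DecidableEq A] (X : Matrix A A ℂ) :
    dephase X = ∑ a, X a a • ketbra a := by
  ext b b'
  change Matrix.diagonal X.diag b b' = _
  rw [Matrix.sum_apply]
  by_cases h : b = b'
  · subst h
    simp [ketbra, Matrix.single_apply]
  · rw [Matrix.diagonal_apply_ne _ h]
    symm
    refine Finset.sum_eq_zero fun a _ => ?_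
    simp [ketbra, Matrix.single_apply]
    rintro rfl h'
    exact absurd h' h

/-! ### Trace-preserving and Hermiticity-preserving maps -/

/-- Trace-preserving maps. -/
def TracePreserving [Fintype A] [Fintype B] (Φ : SOp A B) : Prop :=
  ∀ X, (Φ X).trace = X.trace

/-- Maps that commute with the adjoint. -/
def HermitianPreserving (Φ : SOp A B) : Prop :=
  ∀ X, Φ X.conjTranspose = (Φ X).conjTranspose

theorem TracePreserving.tensorId [Fintype A] [Fintype B] [Fintype C] {Φ : SOp A B}
    (h : TracePreserving Φ) : TracePreserving (tensorId Φ C) := by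
  intro X
  have h₁ : (QEnc.tensorId Φ C X).trace =
      ∑ c, (Φ (Matrix.of fun a a' => X (a, c) (a', c))).trace := by
    simp only [Matrix.trace, Matrix.diag, Fintype.sum_prod_type_right]
    rfl
  rw [h₁, Finset.sum_congr rfl fun c _ => h _]
  simp only [Matrix.trace, Matrix.diag, Fintype.sum_prod_type_right]
  rfl

theorem HermitianPreserving.tensorId {Φ : SOp A B} (h : HermitianPreserving Φ) :
    HermitianPreserving (tensorId Φ C) := by
  intro X
  ext ⟨b, c⟩ ⟨b', c'⟩
  -- The adjoint exchanges block indices: block `(c, c')` of the adjoint is the adjoint of block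
  -- `(c', c)`.
  have := h (Matrix.of fun a a' => X (a, c') (a', c))
  exact congrFun (congrFun this b) b'

theorem TracePreserving.relabel [Fintype A] [Fintype B] (e : A ≃ B) :
    TracePreserving (relabel e) := fun _ =>
  Fintype.sum_equiv e.symm _ _ fun _ => rfl

theorem HermitianPreserving.relabel (e : A ≃ B) : HermitianPreserving (relabel e) :=
  fun _ => rfl

theorem TracePreserving.replaceBy [Fintype A] [Fintype B] [DecidableEq B] (x : B) :
    TracePreserving (replaceBy x : SOp A B) := fun X => by
  change (X.trace • ketbra x).trace = _
  rw [Matrix.trace_smul, trace_ketbra, smul_eq_mul, mul_one]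

theorem HermitianPreserving.replaceBy [Fintype A] [DecidableEq B] (x : B) :
    HermitianPreserving (replaceBy x : SOp A B) := fun X => by
  change X.conjTranspose.trace • ketbra x = (X.trace • ketbra x).conjTranspose
  rw [Matrix.trace_conjTranspose, Matrix.conjTranspose_smul]
  simp [ketbra]

theorem TracePreserving.dephase [Fintype A] [DecidableEq A] :
    TracePreserving (dephase : SOp A A) := fun X => by
  change (Matrix.diagonal X.diag).trace = _
  rw [Matrix.trace_diagonal]
  rfl

theorem HermitianPreserving.dephase [DecidableEq A] :
    HermitianPreserving (dephase : SOp A A) := fun X => by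
  change Matrix.diagonal X.conjTranspose.diag = (Matrix.diagonal X.diag).conjTranspose
  rw [Matrix.diagonal_conjTranspose]
  rfl

theorem TracePreserving.conjugate [Fintype A] [DecidableEq A] {U : Matrix A A ℂ}
    (h : U.conjTranspose * U = 1) : TracePreserving (conjugate U) := fun X => by
  change (U * X * U.conjTranspose).trace = _
  rw [Matrix.trace_mul_comm, ← mul_assoc, h, one_mul]

theorem HermitianPreserving.conjugate [Fintype A] (U : Matrix A A ℂ) :
    HermitianPreserving (conjugate U) := fun X => by
  change U * X.conjTranspose * U.conjTranspose = (U * X * U.conjTranspose).conjTranspose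
  simp [Matrix.conjTranspose_mul, mul_assoc]

end Maps

/-! ### Gates and oracle-free circuits preserve trace and Hermiticity -/

theorem hadamardMatrix_isometry (k : ℕ) :
    (hadamardMatrix k).conjTranspose * hadamardMatrix k = 1 := by
  have hs : (√2 : ℂ)⁻¹ * (√2 : ℂ)⁻¹ = 2⁻¹ := by
    rw [← mul_inv, ← Complex.ofReal_mul, Real.mul_self_sqrt (by norm_num)]
    norm_num
  ext x y
  simp only [Matrix.mul_apply, Matrix.conjTranspose_apply, hadamardMatrix, Matrix.of_apply,
    star_prod, ← Finset.prod_mul_distrib]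
  let f : Fin k → Bool → ℂ := fun i b =>
    star (if b && x i then -(1 / (√2 : ℂ)) else 1 / (√2 : ℂ)) *
      (if b && y i then -(1 / (√2 : ℂ)) else 1 / (√2 : ℂ))
  -- Exchanging sum and product factors the entry over the qubits; each factor is an entry of the
  -- one-qubit identity.
  have h := (Finset.prod_univ_sum (fun _ : Fin k => (Finset.univ : Finset Bool)) f).symm
  rw [Fintype.piFinset_univ] at h
  refine h.trans ?_
  have hf : ∀ i, ∑ b, f i b = if x i = y i then 1 else 0 := by
    intro i
    simp only [f, Fintype.sum_bool]
    cases x i <;> cases y i <;> simp [Complex.conj_ofReal, hs] <;> norm_num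
  simp only [hf, Matrix.one_apply, Finset.prod_ite_zero, Finset.mem_univ, true_imp_iff,
    Finset.prod_const_one, funext_iff]

theorem phaseMatrix_isometry (k : ℕ) :
    (phaseMatrix k).conjTranspose * phaseMatrix k = 1 := by
  rw [phaseMatrix, Matrix.diagonal_conjTranspose, Matrix.diagonal_mul_diagonal,
    ← Matrix.diagonal_one]
  congr 1
  funext x
  simp only [Pi.star_apply, star_prod, ← Finset.prod_mul_distrib]
  refine Finset.prod_eq_one fun i _ => ?_
  cases x i
  · simp
  · simp only [if_true, Complex.star_def, ← Complex.exp_conj, ← Complex.exp_add]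
    have h4 : (starRingEnd ℂ) 4 = 4 := Complex.conj_ofNat 4
    simp [h4, neg_div]

theorem Gate.tracePreserving {R S : Reg} (g : Gate R S) : TracePreserving g.sem := by
  cases g with
  | init => exact TracePreserving.replaceBy _
  | discard => exact TracePreserving.replaceBy _
  | measure => exact TracePreserving.dephase
  | hadamard => exact TracePreserving.conjugate (hadamardMatrix_isometry _)
  | phase => exact TracePreserving.conjugate (phaseMatrix_isometry _)
  | _ => exact TracePreserving.relabel _

theorem Gate.hermitianPreserving {R S : Reg} (g : Gate R S) : HermitianPreserving g.sem := by
  cases g with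
  | init => exact HermitianPreserving.replaceBy _
  | discard => exact HermitianPreserving.replaceBy _
  | measure => exact HermitianPreserving.dephase
  | hadamard => exact HermitianPreserving.conjugate _
  | phase => exact HermitianPreserving.conjugate _
  | _ => exact HermitianPreserving.relabel _

section Circuits

variable {m c : ℕ} {R S : Reg}

/-- Every elementary step preserves the trace, but an oracle gate may be interpreted by any linear
map, so oracle gates have to be excluded. -/
theorem Circ.tracePreserving (O : OracleMaps m c) (Q : Circ m c R S) (h : Q.oracles ⊆ ∅) :
    TracePreserving (Q.sem O) := by
  induction Q with
  | gate g => exact g.tracePreserving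
  | oracle o => exact absurd (h rfl) (Set.notMem_empty o)
  | seq C D ihC ihD =>
    intro X
    exact (ihD (Set.subset_union_right.trans h) _).trans
      (ihC (Set.subset_union_left.trans h) X)
  | frame C T ih => exact (ih h).tensorId

theorem Circ.hermitianPreserving (O : OracleMaps m c) (Q : Circ m c R S) (h : Q.oracles ⊆ ∅) :
    HermitianPreserving (Q.sem O) := by
  induction Q with
  | gate g => exact g.hermitianPreserving
  | oracle o => exact absurd (h rfl) (Set.notMem_empty o)
  | seq C D ihC ihD =>
    intro X
    exact (congrArg _ (ihC (Set.subset_union_left.trans h) X)).trans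
      (ihD (Set.subset_union_right.trans h) _)
  | frame C T ih => exact (ih h).tensorId

/-- The map of a circuit without oracle gates does not depend on the oracles. -/
theorem Circ.sem_congr (O O' : OracleMaps m c) (Q : Circ m c R S) (h : Q.oracles ⊆ ∅) :
    Q.sem O = Q.sem O' := by
  induction Q with
  | gate g => rfl
  | oracle o => exact absurd (h rfl) (Set.notMem_empty o)
  | seq C D ihC ihD =>
    simp only [Circ.sem, ihC (Set.subset_union_left.trans h),
      ihD (Set.subset_union_right.trans h)]
  | frame C T ih => simp only [Circ.sem, ih h]

end Circuits

/-! ### Building uniform families of circuits -/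

/-- The uniform family of pairs of two uniform families of registers. -/
@[reducible]
def RegFamily.pair (E F : RegFamily) : RegFamily where
  reg n := E.reg n ⊗ᵣ F.reg n
  uniform := (E.uniform.append F.uniform).cons _

/-- The registers without qubits. -/
@[reducible]
def RegFamily.empty : RegFamily where
  reg _ := .qubits 0
  uniform := Printable.singleton _

namespace QPT

variable {m c : ℕ → ℕ} {Ω : Set Oracle} {R S T : ℕ → Reg}

/-- A uniform family of elementary steps. -/
def ofGate (g : ∀ n, Gate (R n) (S n)) (h : Printable fun n => (g n).code) : QPT m c Ω R S where
  circ n := .gate (g n)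
  uniform := h
  oracles_subset _ := Set.empty_subset _

/-- Sequential composition. -/
def seq (Q : QPT m c Ω R S) (Q' : QPT m c Ω S T) : QPT m c Ω R T where
  circ n := .seq (Q.circ n) (Q'.circ n)
  uniform := (Q.uniform.append Q'.uniform).cons _
  oracles_subset n := Set.union_subset (Q.oracles_subset n) (Q'.oracles_subset n)

/-- The addition of idle wires. -/
def frame (Q : QPT m c Ω R S) (F : RegFamily) :
    QPT m c Ω (fun n => R n ⊗ᵣ F.reg n) (fun n => S n ⊗ᵣ F.reg n) where
  circ n := .frame (Q.circ n) (F.reg n)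
  uniform := (Q.uniform.append F.uniform).cons _
  oracles_subset := Q.oracles_subset

/-- An algorithm with access to fewer oracles. -/
def mono (Q : QPT m c ∅ R S) (Ω : Set Oracle) : QPT m c Ω R S where
  circ := Q.circ
  uniform := Q.uniform
  oracles_subset n := (Q.oracles_subset n).trans (Set.empty_subset _)

/-- A call of the encryption oracle. -/
def callEnc (hm : Printable fun n => (Reg.qubits (m n)).code)
    (hc : Printable fun n => (Reg.qubits (c n)).code) (h : Oracle.enc ∈ Ω) :
    QPT m c Ω (fun n => .qubits (m n)) (fun n => .qubits (c n)) where
  circ _ := .oracle .enc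
  uniform := (hm.append hc).cons _
  oracles_subset _ := Set.singleton_subset_iff.2 h

/-- The preparation of the all-zero state. -/
def prepare {l : ℕ → ℕ} (h : Printable fun n => (Reg.qubits (l n)).code) :
    QPT m c Ω (fun _ => .qubits 0) (fun n => .qubits (l n)) :=
  ofGate (fun n => .init (l n)) (h.cons _)

/-- The preparation of an all-zero register to the left of the given one. -/
def prepareLeft {l : ℕ → ℕ} (h : Printable fun n => (Reg.qubits (l n)).code) (F : RegFamily) :
    QPT m c Ω F.reg (fun n => .qubits (l n) ⊗ᵣ F.reg n) :=
  (ofGate (fun n => .tUnit (F.reg n)) (F.uniform.cons _)).seq ((prepare h).frame F)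

/-- The copying of classical bits. -/
def copy {l : ℕ → ℕ} (h : Printable fun n => (Reg.qubits (l n)).code) :
    QPT m c Ω (fun n => .qubits (l n)) (fun n => .qubits (l n) ⊗ᵣ .qubits (l n)) :=
  ((prepareLeft h ⟨_, h⟩).seq
    (ofGate (fun n => .swap (.qubits (l n)) (.qubits (l n))) ((h.append h).cons _))).seq
    (ofGate (fun n => .cnot (l n)) (h.cons _))

theorem prepareLeft_sem {l : ℕ → ℕ} (h : Printable fun n => (Reg.qubits (l n)).code)
    (F : RegFamily) (n : ℕ) (O : OracleMaps (m n) (c n))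
    (X : Matrix (F.reg n).Basis (F.reg n).Basis ℂ) :
    (((prepareLeft h F : QPT m c Ω _ _).circ n).sem O) X =
      ketbra (Reg.zero (.qubits (l n))) ⊗ₖ X := by
  change tensorId (replaceBy (Reg.zero (.qubits (l n)))) _
    (relabel (Equiv.uniqueProd _ (Fin 0 → Bool)).symm X) = _
  rw [relabel_uniqueProd_symm (fun _ => false), tensorId_kronecker, replaceBy_ketbra]

/-- CNOT gates onto a zero register send `|x, 0⟩` to `|x, x⟩`. Only basis states are duplicated,
which is enough for classical keys. -/
theorem copy_sem {l : ℕ → ℕ} (h : Printable fun n => (Reg.qubits (l n)).code) (n : ℕ)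
    (O : OracleMaps (m n) (c n)) (x : Fin (l n) → Bool) :
    (((copy h : QPT m c Ω _ _).circ n).sem O) (ketbra x) = ketbra x ⊗ₖ ketbra x := by
  change relabel (cnotEquiv (l n)) (relabel (Equiv.prodComm _ _)
    ((((prepareLeft h ⟨_, h⟩ : QPT m c Ω _ _).circ n).sem O) (ketbra x))) = _
  rw [prepareLeft_sem]
  change relabel (cnotEquiv (l n)) (relabel (Equiv.prodComm _ _) (ketbra _ ⊗ₖ ketbra x)) = _
  rw [relabel_prodComm_kronecker, ketbra_kronecker_ketbra, ketbra_kronecker_ketbra,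
    relabel_ketbra]
  congr 1
  refine Prod.ext rfl (funext fun i => ?_)
  change xor (x i) false = x i
  simp

end QPT

/-! ### Building parties -/

/-- Settings whose registers are uniform, and in which the public part of a key can be copied. -/
structure Setting.Feasible (P : Setting) : Prop where
  msgLen_uniform : Printable fun n => (Reg.qubits (P.msgLen n)).code
  ctLen_uniform : Printable fun n => (Reg.qubits (P.ctLen n)).code
  pub_uniform : Printable fun n => (P.pubReg n).code
  exists_copy : ∀ Ω, ∃ Q : QPT P.msgLen P.ctLen Ω P.pubReg (fun n => P.pubReg n ⊗ᵣ P.pubReg n),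
    ∀ n κ O, (Q.circ n).sem O (ketbra (P.pub n κ)) =
      ketbra (P.pub n κ) ⊗ₖ ketbra (P.pub n κ)

namespace Setting

/-- The plaintext registers. -/
@[reducible]
def Feasible.msgReg {P : Setting} (hP : P.Feasible) : RegFamily := ⟨_, hP.msgLen_uniform⟩

/-- The ciphertext registers. -/
@[reducible]
def Feasible.ctReg {P : Setting} (hP : P.Feasible) : RegFamily := ⟨_, hP.ctLen_uniform⟩

/-- The public registers. -/
@[reducible]
def Feasible.pubFamily {P : Setting} (hP : P.Feasible) : RegFamily := ⟨_, hP.pub_uniform⟩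

variable {P : Setting} {a : Attack}

/-- A party that ignores the public register. -/
def Party.ofQPT (hP : P.Feasible) (R : RegFamily) {S : ℕ → Reg}
    (Q : QPT P.msgLen P.ctLen a.oracles R.reg S) : P.Party a R.reg S :=
  (((QPT.ofGate (fun n => .discard (P.pubReg n)) (hP.pub_uniform.cons _)).frame R).seq
    (QPT.ofGate (fun n => .tUnit' (R.reg n)) (R.uniform.cons _))).seq Q

theorem Party.ofQPT_run (hP : P.Feasible) (R : RegFamily) {S : ℕ → Reg}
    (Q : QPT P.msgLen P.ctLen a.oracles R.reg S) (n : ℕ) (κ : P.Key n) :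
    (Party.ofQPT hP R Q).run n κ = (Q.circ n).sem (P.oracleMaps n κ) := by
  refine LinearMap.ext fun X => ?_
  change (Q.circ n).sem (P.oracleMaps n κ) (relabel (Equiv.uniqueProd _ (Fin 0 → Bool))
    (tensorId (replaceBy (Reg.zero (.qubits 0))) _ (ketbra (P.pub n κ) ⊗ₖ X))) = _
  rw [tensorId_kronecker, replaceBy_ketbra]
  exact congrArg _ (relabel_uniqueProd_ketbra _ X)

/-- A party acting on a part of a register. -/
def Party.frame (hP : P.Feasible) (R F : RegFamily) {S : ℕ → Reg} (A : P.Party a R.reg S) :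
    P.Party a (R.pair F).reg (fun n => S n ⊗ᵣ F.reg n) :=
  (QPT.ofGate (fun n => .assoc' (P.pubReg n) (R.reg n) (F.reg n))
    (((hP.pub_uniform.append R.uniform).append F.uniform).cons _)).seq (QPT.frame A F)

theorem Party.frame_run (hP : P.Feasible) (R F : RegFamily) {S : ℕ → Reg}
    (A : P.Party a R.reg S) (n : ℕ) (κ : P.Key n) :
    (Party.frame hP R F A).run n κ = tensorId (A.run n κ) (F.reg n).Basis := rfl

/-- Two parties acting one after the other. -/
def Party.andThen (hP : P.Feasible) (R S : RegFamily) {T : ℕ → Reg}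
    (A : P.Party a R.reg S.reg) (B : P.Party a S.reg T) : P.Party a R.reg T :=
  ((((QPT.frame (hP.exists_copy a.oracles).choose R).seq
    (QPT.ofGate (fun n => .assoc (P.pubReg n) (P.pubReg n) (R.reg n))
      (((hP.pub_uniform.append hP.pub_uniform).append R.uniform).cons _))).seq
    (QPT.ofGate (fun n => .swap (P.pubReg n) (P.pubReg n ⊗ᵣ R.reg n))
      ((hP.pub_uniform.append ((hP.pub_uniform.append R.uniform).cons _)).cons _))).seq
    ((QPT.frame A hP.pubFamily).seq
      (QPT.ofGate (fun n => .swap (S.reg n) (P.pubReg n))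
        ((S.uniform.append hP.pub_uniform).cons _)))).seq B

/-- `A` consumes the public register, so a copy is made beforehand and kept on idle wires for `B`.
On product states all the rewiring is explicit. -/
theorem Party.andThen_run (hP : P.Feasible) (R S : RegFamily) {T : ℕ → Reg}
    (A : P.Party a R.reg S.reg) (B : P.Party a S.reg T) (n : ℕ) (κ : P.Key n) :
    (Party.andThen hP R S A B).run n κ = B.run n κ ∘ₗ A.run n κ := by
  refine LinearMap.ext fun X => ?_
  change (B.circ n).sem (P.oracleMaps n κ) (relabel (Equiv.prodComm _ _)
    (tensorId ((A.circ n).sem (P.oracleMaps n κ)) _ (relabel (Equiv.prodComm _ _)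
      (relabel (Equiv.prodAssoc _ _ _)
        (tensorId (((hP.exists_copy a.oracles).choose.circ n).sem (P.oracleMaps n κ)) _
          (ketbra (P.pub n κ) ⊗ₖ X)))))) = _
  rw [tensorId_kronecker, (hP.exists_copy a.oracles).choose_spec, relabel_prodAssoc_kronecker,
    relabel_prodComm_kronecker, tensorId_kronecker, relabel_prodComm_kronecker]
  rfl

end Setting

/-! ### Negligible functions -/

theorem Negligible.add {ε δ : ℕ → ℝ} (hε : Negligible ε) (hδ : Negligible δ) :
    Negligible fun n => ε n + δ n := by
  intro p hp
  -- Testing both functions against `2 * p` makes each smaller than half of the required bound.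
  have h2 : (2 * p : Polynomial ℕ) ≠ 0 := mul_ne_zero two_ne_zero hp
  filter_upwards [hε _ h2, hδ _ h2] with n h h'
  have e : ((Polynomial.eval n (2 * p) : ℕ) : ℝ) = 2 * ((p.eval n : ℕ) : ℝ) := by
    simp [Polynomial.eval_mul]
  rw [e] at h h'
  have : (1 : ℝ) / ((p.eval n : ℕ) : ℝ) =
      1 / (2 * ((p.eval n : ℕ) : ℝ)) + 1 / (2 * ((p.eval n : ℕ) : ℝ)) := by
    rw [one_div, one_div, mul_inv]; ring
  linarith

theorem Negligible.mono {ε δ : ℕ → ℝ} (hε : Negligible ε) (h : ∀ n, δ n ≤ ε n) :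
    Negligible δ := fun p hp =>
  (hε p hp).mono fun n hn => (h n).trans_lt hn

/-! ### Empty registers and resetting the plaintext -/

namespace QPT

variable {m c : ℕ → ℕ} {Ω : Set Oracle}

/-- The insertion of an empty register. -/
def insertEmpty (R E : RegFamily) :
    QPT m c Ω (fun n => R.reg n ⊗ᵣ E.reg n)
      (fun n => R.reg n ⊗ᵣ ((RegFamily.empty.pair E).reg n)) :=
  ((ofGate (fun n => .swap (R.reg n) (E.reg n)) ((R.uniform.append E.uniform).cons _)).seq
    (frame (ofGate (fun n => .tUnit (E.reg n)) (E.uniform.cons _)) R)).seq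
    (ofGate (fun n => .swap ((RegFamily.empty.pair E).reg n) (R.reg n))
      (((RegFamily.empty.pair E).uniform.append R.uniform).cons _))

/-- The removal of an empty register. -/
def dropEmpty (R : RegFamily) :
    QPT m c Ω (R.pair RegFamily.empty).reg R.reg :=
  (ofGate (fun n => .swap (R.reg n) (.qubits 0))
    ((R.uniform.append RegFamily.empty.uniform).cons _)).seq
    (ofGate (fun n => .tUnit' (R.reg n)) (R.uniform.cons _))

/-- The replacement of the first register by the all-zero state. -/
def resetLeft {l : ℕ → ℕ} (h : Printable fun n => (Reg.qubits (l n)).code) (E : RegFamily) :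
    QPT m c Ω (fun n => .qubits (l n) ⊗ᵣ E.reg n) (fun n => .qubits (l n) ⊗ᵣ E.reg n) :=
  frame ((ofGate (fun n => .discard (.qubits (l n))) (h.cons _)).seq (prepare h)) E

theorem resetLeft_sem {l : ℕ → ℕ} (h : Printable fun n => (Reg.qubits (l n)).code)
    (E : RegFamily) (n : ℕ) (O : OracleMaps (m n) (c n))
    (X : Matrix ((Fin (l n) → Bool) × (E.reg n).Basis) ((Fin (l n) → Bool) × (E.reg n).Basis) ℂ) :
    ((resetLeft h E : QPT m c Ω _ _).circ n).sem O X =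
      ketbra (Reg.zero (.qubits (l n))) ⊗ₖ traceFst X := by
  change tensorId (replaceBy (Reg.zero (.qubits (l n)))) _
    (tensorId (replaceBy (Reg.zero (.qubits 0))) _ X) = _
  rw [tensorId_replaceBy, tensorId_replaceBy, traceFst_kronecker, trace_ketbra, one_smul]

end QPT

namespace Setting

variable {P : Setting} {a : Attack}

/-! ### Semantic security implies indistinguishability -/

/-- The adversary forwards the ciphertext, its side register is empty, and the register `E` of the
IND game takes the role of `F`. The simulator depends on the adversary alone, so one `S` serves both
the original generator and the one that resets the plaintext. -/
theorem Feasible.ind_of_sem (hP : P.Feasible) (h : P.SEM a) : P.IND a := by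
  intro E M D
  obtain ⟨S, hS⟩ := h RegFamily.empty hP.ctReg
    (Party.ofQPT hP (hP.ctReg.pair RegFamily.empty) (QPT.dropEmpty hP.ctReg))
  let M₁ : P.Generator a (fun n => RegFamily.empty.reg n ⊗ᵣ E.reg n) :=
    QPT.seq M (QPT.insertEmpty hP.msgReg E)
  let M₂ : P.Generator a (fun n => RegFamily.empty.reg n ⊗ᵣ E.reg n) :=
    QPT.seq (QPT.seq M (QPT.resetLeft hP.msgLen_uniform E)) (QPT.insertEmpty hP.msgReg E)
  have real : ∀ n κ (ρ : Matrix ((Fin (P.msgLen n) → Bool) × (E.reg n).Basis)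
      ((Fin (P.msgLen n) → Bool) × (E.reg n).Basis) ℂ),
      tensorId ((Party.ofQPT hP (hP.ctReg.pair RegFamily.empty)
        (QPT.dropEmpty hP.ctReg) : P.Party a _ _).run n κ) (E.reg n).Basis
        (relabel (Equiv.prodAssoc _ _ _).symm
          (tensorId (P.enc n κ) ((Fin 0 → Bool) × (E.reg n).Basis)
            (relabel (Equiv.prodCongr (Equiv.refl _)
              (Equiv.uniqueProd _ (Fin 0 → Bool)).symm) ρ))) =
      tensorId (P.enc n κ) (E.reg n).Basis ρ := by
    intro n κ ρ
    rw [Party.ofQPT_run]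
    rfl
  have state₁ : ∀ n κ, M₁.state n κ = relabel (Equiv.prodCongr (Equiv.refl _)
      (Equiv.uniqueProd _ (Fin 0 → Bool)).symm) (M.state n κ) := fun _ _ => rfl
  have state₂ : ∀ n κ, M₂.state n κ = relabel (Equiv.prodCongr (Equiv.refl _)
      (Equiv.uniqueProd _ (Fin 0 → Bool)).symm)
        (ketbra (Reg.zero (.qubits (P.msgLen n))) ⊗ₖ traceFst (M.state n κ)) := by
    intro n κ
    rw [← QPT.resetLeft_sem hP.msgLen_uniform E n (P.oracleMaps n κ) (Ω := a.genOracles)]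
    rfl
  -- Resetting the plaintext does not affect the state of the other registers, so both generators
  -- lead to the same simulated game.
  have ideal : ∀ n κ, traceFst (M₂.state n κ) = traceFst (M₁.state n κ) := by
    intro n κ
    have ht : traceFst (ketbra (Reg.zero (.qubits (P.msgLen n))) ⊗ₖ
        traceFst (M.state n κ)) = traceFst (M.state n κ) := by
      rw [traceFst_kronecker, trace_ketbra, one_smul]
    rw [state₁, state₂]
    exact congrArg (relabel (Equiv.uniqueProd _ (Fin 0 → Bool)).symm) ht
  -- Triangle inequality through the common value of the simulated game.
  refine ((hS E M₁ D).add (hS E M₂ D)).mono fun n => ?_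
  simp only [ideal]
  simp only [state₁, state₂]
  have e : ∀ ρ : ∀ κ, Matrix ((Fin (P.msgLen n) → Bool) × (E.reg n).Basis)
      ((Fin (P.msgLen n) → Bool) × (E.reg n).Basis) ℂ, P.mean n (fun κ => probOne (D.run n κ
        (tensorId (P.enc n κ) (E.reg n).Basis (ρ κ)))) = P.mean n (fun κ => probOne (D.run n κ
      (tensorId ((Party.ofQPT hP (hP.ctReg.pair RegFamily.empty)
        (QPT.dropEmpty hP.ctReg) : P.Party a _ _).run n κ) (E.reg n).Basis
        (relabel (Equiv.prodAssoc _ _ _).symm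
          (tensorId (P.enc n κ) ((Fin 0 → Bool) × (E.reg n).Basis)
            (relabel (Equiv.prodCongr (Equiv.refl _)
              (Equiv.uniqueProd _ (Fin 0 → Bool)).symm) (ρ κ))))))) := fun ρ => by
    congr 1
    funext κ
    exact congrArg (fun X => probOne (D.run n κ X)) (real n κ (ρ κ)).symm
  rw [e, e]
  refine (abs_sub_le _ _ _).trans (add_le_add le_rfl ?_)
  rw [abs_sub_comm]

/-! ### Indistinguishability implies semantic security -/

/-- `Z` imitates the encryption of the all-zero state well enough for the games: no distinguisher
tells its output from such an encryption. -/
def Imitates (Z : P.Party a RegFamily.empty.reg (fun n => .qubits (P.ctLen n))) : Prop :=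
  ∀ (E : RegFamily) (M : P.Generator a E.reg)
    (D : P.Party a (fun n => .qubits (P.ctLen n) ⊗ᵣ E.reg n) (fun _ => .qubits 1)) (n : ℕ),
    P.mean n (fun κ => probOne (D.run n κ
      (P.enc n κ (ketbra (Reg.zero (.qubits (P.msgLen n)))) ⊗ₖ traceFst (M.state n κ)))) =
    P.mean n (fun κ => probOne (D.run n κ
      (Z.run n κ (ketbra (Reg.zero (.qubits 0))) ⊗ₖ traceFst (M.state n κ))))

/-- The simulator `S` runs `Z` and then `A`; the IND distinguisher `D'` runs `A` and then `D`. With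
`E ⊗ F` as side register, both games of IND turn into those of SEM without any loss. -/
theorem Feasible.sem_of_ind (hP : P.Feasible)
    (hZ : ∃ Z : P.Party a RegFamily.empty.reg (fun n => .qubits (P.ctLen n)), Imitates Z)
    (h : P.IND a) : P.SEM a := by
  intro E G A
  obtain ⟨Z, hZ⟩ := hZ
  let I : P.Party a E.reg (RegFamily.empty.pair E).reg :=
    Party.ofQPT hP E (QPT.ofGate (fun n => .tUnit (E.reg n)) (E.uniform.cons _))
  let S₁ : P.Party a E.reg (hP.ctReg.pair E).reg :=
    Party.andThen hP E (RegFamily.empty.pair E) I (Party.frame hP RegFamily.empty E Z)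
  let S : P.Party a E.reg G.reg := Party.andThen hP E (hP.ctReg.pair E) S₁ A
  have hS : ∀ n κ X, S.run n κ X =
      A.run n κ (Z.run n κ (ketbra (Reg.zero (.qubits 0))) ⊗ₖ X) := by
    intro n κ X
    refine (LinearMap.congr_fun (Party.andThen_run hP E _ S₁ A n κ) X).trans ?_
    refine congrArg (A.run n κ)
      ((LinearMap.congr_fun (Party.andThen_run hP E _ I _ n κ) X).trans ?_)
    rw [Party.ofQPT_run, Party.frame_run]
    change (tensorId (Z.run n κ) _
      (relabel (Equiv.uniqueProd _ (Fin 0 → Bool)).symm X)) = _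
    rw [relabel_uniqueProd_symm (fun _ => false), tensorId_kronecker]
    rfl
  refine ⟨S, fun F M D => ?_⟩
  let R : RegFamily := hP.ctReg.pair (E.pair F)
  let T : RegFamily := (hP.ctReg.pair E).pair F
  let D₁ : P.Party a R.reg T.reg := Party.ofQPT hP R
    (QPT.ofGate (fun n => .assoc' (hP.ctReg.reg n) (E.reg n) (F.reg n))
      (((hP.ctReg.uniform.append E.uniform).append F.uniform).cons _))
  let D₂ : P.Party a T.reg (fun _ => .qubits 1) :=
    Party.andThen hP T (G.pair F) (Party.frame hP (hP.ctReg.pair E) F A) D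
  let D' : P.Party a R.reg (fun _ => .qubits 1) := Party.andThen hP R T D₁ D₂
  have hD : ∀ n κ (X : Matrix (R.reg n).Basis (R.reg n).Basis ℂ),
      D'.run n κ X = D.run n κ (tensorId (A.run n κ) (F.reg n).Basis
        (relabel (Equiv.prodAssoc _ _ _).symm X)) := by
    intro n κ X
    refine (LinearMap.congr_fun (Party.andThen_run hP R T D₁ D₂ n κ) X).trans ?_
    refine (LinearMap.congr_fun (Party.andThen_run hP T (G.pair F)
      (Party.frame hP (hP.ctReg.pair E) F A) D n κ) (D₁.run n κ X)).trans ?_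
    refine congrArg (fun Y => D.run n κ (tensorId (A.run n κ) (F.reg n).Basis Y)) ?_
    exact LinearMap.congr_fun (Party.ofQPT_run hP R _ n κ) X
  refine (h (E.pair F) M D').mono fun n => le_of_eq ?_
  have hz : P.mean n (fun κ => probOne (D'.run n κ
      (tensorId (P.enc n κ) ((E.pair F).reg n).Basis
        (ketbra (Reg.zero (.qubits (P.msgLen n))) ⊗ₖ traceFst (M.state n κ))))) =
      P.mean n (fun κ => probOne (D.run n κ
        (tensorId (S.run n κ) (F.reg n).Basis (traceFst (M.state n κ))))) := by
    simp only [tensorId_kronecker]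
    -- The encryption of zero and `Z` are exchanged under the average over keys; for a fixed key the
    -- two values may differ.
    refine (hZ (E.pair F) M D' n).trans ?_
    congr 1
    funext κ
    refine congrArg probOne ((hD n κ _).trans (congrArg (D.run n κ) ?_))
    -- `S` acts on each block over `F` as `A` does after `Z` has been adjoined, so entries can be
    -- compared block by block.
    ext ⟨g, f⟩ ⟨g', f'⟩
    rw [tensorId_apply, tensorId_apply, hS]
    rfl
  have hr : P.mean n (fun κ => probOne (D'.run n κ
      (tensorId (P.enc n κ) ((E.pair F).reg n).Basis (M.state n κ)))) =
      P.mean n (fun κ => probOne (D.run n κ (tensorId (A.run n κ) (F.reg n).Basis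
        (relabel (Equiv.prodAssoc _ _ _).symm
          (tensorId (P.enc n κ) ((E.reg n).Basis × (F.reg n).Basis) (M.state n κ)))))) := by
    congr 1
    funext κ
    exact congrArg probOne (hD n κ _)
  exact congrArg abs (congrArg₂ (· - ·) hr.symm hz.symm)

theorem imitates_of_run_eq {Z : P.Party a RegFamily.empty.reg (fun n => .qubits (P.ctLen n))}
    (h : ∀ n κ, Z.run n κ (ketbra (Reg.zero (.qubits 0))) =
      P.enc n κ (ketbra (Reg.zero (.qubits (P.msgLen n))))) : Imitates Z := by
  intro E M D n
  simp only [h]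

/-- With an encryption oracle, the all-zero state can be encrypted. -/
theorem Feasible.exists_imitates (hP : P.Feasible) (ha : Oracle.enc ∈ a.oracles) :
    ∃ Z : P.Party a RegFamily.empty.reg (fun n => .qubits (P.ctLen n)), Imitates Z := by
  refine ⟨Party.ofQPT hP RegFamily.empty ((QPT.prepare hP.msgLen_uniform).seq
    (QPT.callEnc hP.msgLen_uniform hP.ctLen_uniform ha)), imitates_of_run_eq fun n κ => ?_⟩
  rw [Party.ofQPT_run]
  change P.enc n κ (replaceBy (Reg.zero (.qubits (P.msgLen n)))
    (ketbra (Reg.zero (.qubits 0)))) = _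
  rw [replaceBy_ketbra]

end Setting

open Setting

/-! ### The public-key setting -/

theorem PKEScheme.feasible (P : PKEScheme) : P.setting.Feasible where
  msgLen_uniform := P.msgLen_uniform
  ctLen_uniform := P.ctLen_uniform
  pub_uniform := P.pkLen_uniform
  exists_copy _ := ⟨QPT.copy P.pkLen_uniform, fun n κ O => QPT.copy_sem P.pkLen_uniform n O κ.1⟩

/-- In the public-key setting, anyone can encrypt the all-zero state. -/
theorem PKEScheme.exists_imitates (P : PKEScheme) (a : Attack) :
    ∃ Z : P.setting.Party a RegFamily.empty.reg (fun n => .qubits (P.setting.ctLen n)),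
      Imitates Z := by
  let Z₀ : P.setting.Party a RegFamily.empty.reg P.feasible.msgReg.reg :=
    Party.ofQPT P.feasible RegFamily.empty (QPT.prepare P.msgLen_uniform)
  let Z₁ : P.setting.Party a P.feasible.msgReg.reg (fun n => .qubits (P.ctLen n)) :=
    P.enc.mono a.oracles
  refine ⟨Party.andThen P.feasible RegFamily.empty P.feasible.msgReg Z₀ Z₁,
    imitates_of_run_eq fun n κ => ?_⟩
  refine (LinearMap.congr_fun (Party.andThen_run P.feasible RegFamily.empty P.feasible.msgReg
    Z₀ Z₁ n κ) _).trans ?_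
  have h₀ : Z₀.run n κ (ketbra (Reg.zero (.qubits 0))) =
      ketbra (Reg.zero (.qubits (P.msgLen n))) :=
    (LinearMap.congr_fun (Party.ofQPT_run P.feasible RegFamily.empty _ n κ) _).trans
      (replaceBy_ketbra _ _)
  have h₁ : Z₁.run n κ = P.setting.enc n κ :=
    congrArg (feed (P.setting.pub n κ)) (Circ.sem_congr _ _ _ (P.enc.oracles_subset n))
  rw [LinearMap.comp_apply, h₁]
  exact congrArg _ h₀

theorem PKEScheme.sem_iff_ind (P : PKEScheme) (a : Attack) :
    P.setting.SEM a ↔ P.setting.IND a :=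
  ⟨P.feasible.ind_of_sem, P.feasible.sem_of_ind (P.exists_imitates a)⟩

/-! ### The symmetric-key setting -/

theorem SKEScheme.feasible (P : SKEScheme) : P.setting.Feasible where
  msgLen_uniform := P.msgLen_uniform
  ctLen_uniform := P.ctLen_uniform
  pub_uniform := Printable.singleton _
  exists_copy _ := ⟨QPT.copy (l := fun _ => 0) (Printable.singleton _),
    fun n _ O => QPT.copy_sem (l := fun _ => 0) (Printable.singleton _) n O _⟩

/-- The registers of the keys. -/
@[reducible]
def keyReg : RegFamily := ⟨fun n => .qubits n, Printable.qubitsCode⟩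

/-- Taking the real part loses nothing: key generation preserves Hermiticity, and a Hermitian matrix
has a real diagonal. -/
theorem SKETriple.ofReal_keyProb (P : SKETriple) (n : ℕ) (k : Fin n → Bool) :
    (P.keyProb n k : ℂ) = P.keyGen.plain n (ketbra (Reg.zero (.qubits 0))) k k := by
  have h := Circ.hermitianPreserving (fun _ => 0) _ (P.keyGen.oracles_subset n)
    (ketbra (Reg.zero (.qubits 0)))
  rw [show (ketbra (Reg.zero (.qubits 0))).conjTranspose = ketbra (Reg.zero (.qubits 0)) by
    simp [ketbra]] at h
  exact Complex.conj_eq_iff_re.1 (congrFun (congrFun h k) k).symm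

theorem SKETriple.sum_keyProb (P : SKETriple) (n : ℕ) : ∑ k, P.keyProb n k = 1 := by
  have h := Circ.tracePreserving (fun _ => 0) _ (P.keyGen.oracles_subset n)
    (ketbra (Reg.zero (.qubits 0)))
  rw [trace_ketbra] at h
  have h' : ((∑ k, P.keyProb n k : ℝ) : ℂ) = 1 := by
    rw [Complex.ofReal_sum, ← h]
    exact Finset.sum_congr rfl fun k _ => P.ofReal_keyProb n k
  exact_mod_cast h'

/-- The encryption of the all-zero state under a fresh key. -/
def SKETriple.freshEnc (P : SKETriple) (Ω : Set Oracle) :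
    QPT P.msgLen P.ctLen Ω RegFamily.empty.reg (fun n => .qubits (P.ctLen n)) :=
  ((((P.keyGen.mono Ω).seq
    (QPT.ofGate (fun n => .measure n) (Printable.qubitsCode.cons _))).seq
    (QPT.prepareLeft P.msgLen_uniform keyReg)).seq
    (QPT.ofGate (fun n => .swap (.qubits (P.msgLen n)) (.qubits n))
      ((P.msgLen_uniform.append Printable.qubitsCode).cons _))).seq (P.enc.mono Ω)

/-- The measurement leaves only the diagonal of the key register, that is, the key distribution. By
linearity the result is the average of the encryptions, whatever the oracles. -/
theorem SKETriple.freshEnc_sem (P : SKETriple) (Ω : Set Oracle) (n : ℕ)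
    (O : OracleMaps (P.msgLen n) (P.ctLen n)) :
    ((P.freshEnc Ω).circ n).sem O (ketbra (Reg.zero (.qubits 0))) =
      ∑ k, (P.keyProb n k : ℂ) • P.encMap n k (ketbra (Reg.zero (.qubits (P.msgLen n)))) := by
  change (P.enc.circ n).sem O (relabel (Equiv.prodComm _ _)
    ((((QPT.prepareLeft P.msgLen_uniform keyReg :
      QPT P.msgLen P.ctLen Ω _ _).circ n).sem O)
      (dephase ((P.keyGen.circ n).sem O (ketbra (Reg.zero (.qubits 0))))))) = _
  rw [QPT.prepareLeft_sem]
  change (P.enc.circ n).sem O (relabel (Equiv.prodComm _ _) (ketbra _ ⊗ₖ _)) = _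
  rw [relabel_prodComm_kronecker, dephase_eq_sum,
    Circ.sem_congr O (fun _ => 0) _ (P.keyGen.oracles_subset n),
    Circ.sem_congr O (fun _ => 0) _ (P.enc.oracles_subset n)]
  -- Encryption as a linear function of the key register, the plaintext being fixed to zero.
  have h := map_sum (((P.enc.circ n).sem fun _ => 0) ∘ₗ
    (Matrix.kroneckerBilinear (R := ℂ) (α := ℂ)).flip (ketbra (Reg.zero (.qubits (P.msgLen n)))))
    (fun k => (P.keyProb n k : ℂ) • ketbra k) Finset.univ
  simp only [map_smul] at h
  simp only [SKETriple.ofReal_keyProb] at h ⊢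
  exact h

/-- Without oracles, the all-zero state can be encrypted under a fresh key. -/
theorem SKEScheme.exists_imitates_passive (P : SKEScheme) :
    ∃ Z : P.setting.Party .passive RegFamily.empty.reg
      (fun n => .qubits (P.setting.ctLen n)), Imitates Z := by
  refine ⟨Party.ofQPT P.feasible RegFamily.empty (P.freshEnc _), fun E M D n => ?_⟩
  -- Without oracles and with a blank public register, neither the generator nor the distinguisher
  -- depends on the key.
  have hM : ∀ κ κ', M.state n κ = M.state n κ' := fun κ κ' =>
    LinearMap.congr_fun (Circ.sem_congr _ _ _ (M.oracles_subset n)) _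
  have hD : ∀ κ κ', D.run n κ = D.run n κ' := fun κ κ' =>
    congrArg (feed _) (Circ.sem_congr _ _ _ (D.oracles_subset n))
  -- An arbitrary reference key. The functional `L` gives the weight of outcome 1 as a linear
  -- function of the ciphertext alone.
  let κ₀ : Fin n → Bool := fun _ => false
  let L : Matrix (Fin (P.ctLen n) → Bool) (Fin (P.ctLen n) → Bool) ℂ →ₗ[ℂ] ℂ :=
    Matrix.entryLinearMap ℂ ℂ (fun _ => true) (fun _ => true) ∘ₗ D.run n κ₀ ∘ₗ
      (Matrix.kroneckerBilinear (R := ℂ) (α := ℂ)).flip (traceFst (M.state n κ₀))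
  have hL : ∀ (κ : Fin n → Bool) W, probOne (D.run n κ (W ⊗ₖ traceFst (M.state n κ))) =
      (L W).re := by
    intro κ W
    rw [hD κ κ₀, hM κ κ₀]
    rfl
  have hZ : ∀ κ : Fin n → Bool, (Party.ofQPT (a := .passive) P.feasible RegFamily.empty
      (P.freshEnc _)).run n κ (ketbra (Reg.zero (.qubits 0))) =
      ∑ k, (P.keyProb n k : ℂ) • P.encMap n k (ketbra (Reg.zero (.qubits (P.msgLen n)))) :=
    fun κ => (LinearMap.congr_fun (Party.ofQPT_run P.feasible RegFamily.empty _ n κ) _).trans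
      (P.freshEnc_sem _ n _)
  refine (Finset.sum_congr rfl fun κ _ => congrArg (P.keyProb n κ * ·) (hL κ _)).trans ?_
  refine Eq.trans ?_ (Finset.sum_congr rfl fun κ _ => congrArg (P.keyProb n κ * ·)
    ((hL κ _).trans (congrArg (fun W => (L W).re) (hZ κ)))).symm
  -- With `Z` the value is already an average over the fresh key, hence constant in the actual key,
  -- and averaging it again changes nothing.
  have hs : ∀ r : ℝ, ∑ κ, P.keyProb n κ * r = r := fun r => by
    rw [← Finset.sum_mul, P.sum_keyProb, one_mul]
  refine Eq.trans ?_ (hs _).symm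
  rw [map_sum, Complex.re_sum]
  refine Finset.sum_congr rfl fun k _ => ?_
  rw [map_smul, smul_eq_mul, Complex.re_ofReal_mul]
  rfl

theorem SKEScheme.exists_imitates (P : SKEScheme) (a : Attack) :
    ∃ Z : P.setting.Party a RegFamily.empty.reg (fun n => .qubits (P.setting.ctLen n)),
      Imitates Z := by
  cases a with
  | passive => exact P.exists_imitates_passive
  | cpa => exact P.feasible.exists_imitates rfl
  | cca1 => exact P.feasible.exists_imitates rfl

theorem SKEScheme.sem_iff_ind (P : SKEScheme) (a : Attack) :
    P.setting.SEM a ↔ P.setting.IND a :=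
  ⟨P.feasible.ind_of_sem, P.feasible.sem_of_ind (P.exists_imitates a)⟩

end QEnc

end

theorem theorem1 :
    (∀ (P : QEnc.PKEScheme) (a : QEnc.Attack), P.setting.SEM a ↔ P.setting.IND a) ∧
    (∀ (P : QEnc.SKEScheme) (a : QEnc.Attack), P.setting.SEM a ↔ P.setting.IND a) :=
  ⟨fun P => P.sem_iff_ind, fun P => P.sem_iff_ind⟩
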